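/- Let $E$ be an ordered (real) Banach space whose positive cone $K=\{x\in E : x\ge \theta\}$ is normal, i.e. there is $N>0$ with $\|x\|\le N\|y\|$ whenever $\theta\le x\le y$. Let $A:D(A)\subset E\to E$ be a closed linear operator such that $-A$ generates a positive $C_0$-semigroup $T(t)$ $(t\ge 0)$ which is equicontinuous, i.e. $t\mapsto T(t)$ is continuous in operator norm on $(0,\infty)$. Let $\omega,\tau>0$ and let $F:\mathbb R\times E\times E\to E$ be continuous and $\omega$-periodic in its first variable. Consider $$u'(t)+Au(t)=F(t,u(t),u(t-\tau)),\qquad t\in\mathbb R. \tag{1}$$ Let $C_\omega(\mathbb R,E)$ be the space of continuous $\omega$-periodic functions $\mathbb R\to E$, ordered pointwise, and $E_1=D(A)$ with the graph norm. A function $v\in C^1_\omega(\mathbb R,E)\cap C_\omega(\mathbb R,E_1)$ is called an $\omega$-periodic lower (upper) solution of (1) if $v'(t)+Av(t)\le F(t,v(t),v(t-\tau))$ (respectively $\ge$) for all $t\in\mathbb R$. An $\omega$-periodic mild solution of (1) is a function $u\in C_\omega(\mathbb R,E)$ such that $u(t)=T(t-s)u(s)+\int_s^tT(t-r)F(r,u(r),u(r-\tau))\,dr$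 for all $s\le t$. Let $\alpha$ be the Kuratowski measure of noncompactness and let $\nu_0=\inf\{\nu\in\mathbb R : \exists M\ge1\ \forall t\ge0\ \ \|T(t)\|\le Me^{\nu t}\}\in[-\infty,\infty)$ be the growth exponent of $T$. **Theorem 3.5.** Assume that (1) has an $\omega$-periodic lower solution $v_0$ and an $\omega$-periodic upper solution $w_0$ with $v_0\le w_0$, and write $[v_0,w_0]=\{u\in C_\omega(\mathbb R,E): v_0\le u\le w_0\}$. Assume: (H3) there is a constant $C_1>0$ such that $u_2(t)-u_1(t)\ge C_1\,(u_2(t-\tau)-u_1(t-\tau))$ for all $t\in\mathbb R$ and all $u_1,u_2\in[v_0,w_0]$ with $u_1\le u_2$; (H4) there are constants $C_2,C_3\ge0$ such that $$F(t,x_2,y_2)-F(t,x_1,y_1)\ge -C_2(x_2-x_1)-C_3(y_2-y_1)$$ for all $t\in\mathbb R$, $v_0(t)\le x_1\le x_2\le w_0(t)$ and $v_0(t-\tau)\le y_1\le y_2\le w_0(t-\tau)$. Fix a real constant $C\ge C_2+C_3/C_1$ with $C>\nu_0$, and put $S(t)=e^{-Ct}T(t)$. Then $I-S(\omega)$ is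 boundedly invertible. Put $C_S=\|(I-S(\omega))^{-1}\|$, $M_S=\sup_{t\ge0}\|S(t)\|$, and assume moreover: (H2) there is a constant $c\ge0$ with $4c\,\omega\, C_SM_S<1$ such that for all $t\in\mathbb R$ and all monotone (increasing or decreasing) sequences $\{u_n\}\subset[v_0,w_0]$, $$\alpha(\{F(t,u_n(t),u_n(t-\tau))+Cu_n(t)\})\le c\,\big(\alpha(\{u_n(t)\})+\alpha(\{u_n(t-\tau)\})\big).$$ Then (1) has a minimal and a maximal $\omega$-periodic mild solution $\underline u,\overline u$ in $[v_0,w_0]$: both are $\omega$-periodic mild solutions lying in $[v_0,w_0]$, and every $\omega$-periodic mild solution $u\in[v_0,w_0]$ satisfies $\underline u\le u\le\overline u$. They are obtained by monotone iteration: with $$(Qu)(t)=(I-S(\omega))^{-1}\int_{t-\omega}^tS(t-s)\big(F(s,u(s),u(s-\tau))+Cu(s)\big)\,ds,$$ the sequences $v_i=Qv_{i-1}$, $w_i=Qw_{i-1}$ $(i\ge1)$ starting from $v_0$ and $w_0$ lie in $[v_0,w_0]$, satisfy $$v_0\le v_1\le v_2\le\cdots\le v_i\le\cdots\le w_i\le\cdots\le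 w_2\le w_1\le w_0,$$ and $v_i\to\underline u$, $w_i\to\overline u$ uniformly on $\mathbb R$. -/

import Mathlib

open Set Filter Topology MeasureTheory
open scoped ENNReal

noncomputable section

namespace DelayEvolution

/-- Kuratowski's measure of noncompactness: the infimum of all `d` such that `B` has a finite cover
by sets of diameter at most `d`. It is `∞` exactly when `B` is not bounded. -/
def kuratowski {X : Type*} [PseudoEMetricSpace X] (B : Set X) : ℝ≥0∞ :=
  sInf {d | ∃ 𝒞 : Set (Set X), 𝒞.Finite ∧ B ⊆ ⋃₀ 𝒞 ∧ ∀ D ∈ 𝒞, Metric.ediam D ≤ d}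

variable {E : Type*} [NormedAddCommGroup E] [NormedSpace ℝ E]

/-- The family `T` restricted to `[0, ∞)` is a `C₀`-semigroup of bounded operators on `E`. The
values of `T` at negative times are irrelevant and never used. -/
structure IsC0Semigroup (T : ℝ → E →L[ℝ] E) : Prop where
  map_zero : T 0 = 1
  map_add : ∀ s t : ℝ, 0 ≤ s → 0 ≤ t → T (s + t) = T s * T t
  strong_cont : ∀ x : E, Tendsto (fun t => T t x) (𝓝[>] 0) (𝓝 x)

/-- `B` is the infinitesimal generator of `T`: `x ∈ D(B)` and `B x = y` if and only if
`(T(h) x - x) / h → y` as `h → 0+`. -/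
def IsGenerator (B : E →ₗ.[ℝ] E) (T : ℝ → E →L[ℝ] E) : Prop :=
  ∀ x y : E, (x, y) ∈ B.graph ↔ Tendsto (fun h : ℝ => h⁻¹ • (T h x - x)) (𝓝[>] 0) (𝓝 y)

/-- The semigroup `T` is equicontinuous, i.e. continuous in operator norm for `t > 0`. -/
def IsEquicontinuousSemigroup (T : ℝ → E →L[ℝ] E) : Prop :=
  ContinuousOn T (Ioi 0)

/-- The growth exponent of `T`, as an extended real (it is `-∞` e.g. for nilpotent semigroups). -/
def growthExponent (T : ℝ → E →L[ℝ] E) : EReal :=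
  sInf {a | ∃ ν : ℝ, a = (ν : EReal) ∧
    ∃ M : ℝ, 1 ≤ M ∧ ∀ t : ℝ, 0 ≤ t → ‖T t‖ ≤ M * Real.exp (ν * t)}

/-- The rescaled semigroup `S(t) = e^{-Ct} T(t)`. -/
def rescaled (C : ℝ) (T : ℝ → E →L[ℝ] E) (t : ℝ) : E →L[ℝ] E :=
  Real.exp (-C * t) • T t

/-- `C_S = ‖(I - S(ω))⁻¹‖`. -/
def resolventNorm (S : ℝ → E →L[ℝ] E) (ω : ℝ) : ℝ :=
  ‖Ring.inverse (1 - S ω)‖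

/-- `M_S = sup {‖S(t)‖ : t ≥ 0}`. -/
def supNorm (S : ℝ → E →L[ℝ] E) : ℝ :=
  sSup ((fun t => ‖S t‖) '' Ici 0)

/-- `u` is an `ω`-periodic mild solution of `u'(t) + A u(t) = F(t, u(t), u(t - τ))` on `ℝ`, where
`T` is the semigroup generated by `-A`. -/
structure IsPeriodicMildSolution (T : ℝ → E →L[ℝ] E) (F : ℝ → E → E → E) (ω τ : ℝ)
    (u : ℝ → E) : Prop where
  continuous : Continuous u
  periodic : Function.Periodic u ω
  mild : ∀ s t : ℝ, s ≤ t →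
    u t = T (t - s) (u s) + ∫ r in s..t, T (t - r) (F r (u r) (u (r - τ)))

/-- The monotone iteration operator
`(Q u)(t) = (I - S(ω))⁻¹ ∫_{t-ω}^t S(t-s) (F(s, u(s), u(s-τ)) + C u(s)) ds`
with `S(t) = e^{-Ct} T(t)`. -/
def iterOp (T : ℝ → E →L[ℝ] E) (F : ℝ → E → E → E) (ω τ C : ℝ) (u : ℝ → E) (t : ℝ) : E :=
  Ring.inverse (1 - rescaled C T ω)
    (∫ s in (t - ω)..t, rescaled C T (t - s) (F s (u s) (u (s - τ)) + C • u s))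

variable [PartialOrder E]

/-- The positive cone of `E` is normal. -/
def HasNormalCone (E : Type*) [NormedAddCommGroup E] [PartialOrder E] : Prop :=
  ∃ N : ℝ, 0 < N ∧ ∀ x y : E, 0 ≤ x → x ≤ y → ‖x‖ ≤ N * ‖y‖

/-- The semigroup `T` is positive. -/
def IsPositiveSemigroup (T : ℝ → E →L[ℝ] E) : Prop :=
  ∀ t : ℝ, 0 ≤ t → ∀ x : E, 0 ≤ x → 0 ≤ T t x

/-- The order interval `[v, w]` in the space of continuous `ω`-periodic functions `ℝ → E`. -/
def periodicIcc (ω : ℝ) (v w : ℝ → E) : Set (ℝ → E) :=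
  {u | Continuous u ∧ Function.Periodic u ω ∧ (∀ t, v t ≤ u t) ∧ ∀ t, u t ≤ w t}

/-- `v` lies in `C¹_ω(ℝ, E) ∩ C_ω(ℝ, D(A))`, where `D(A)` carries the graph norm of `A`. -/
structure IsPeriodicRegular (A : E →ₗ.[ℝ] E) (ω : ℝ) (v : ℝ → E) : Prop where
  contDiff : ContDiff ℝ 1 v
  periodic : Function.Periodic v ω
  mem_domain : ∀ t, v t ∈ A.domain
  continuous_apply : Continuous fun t => A ⟨v t, mem_domain t⟩

/-- `v` is an `ω`-periodic lower solution of `u'(t) + A u(t) = F(t, u(t), u(t - τ))`. -/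
structure IsLowerSolution (A : E →ₗ.[ℝ] E) (F : ℝ → E → E → E) (ω τ : ℝ) (v : ℝ → E) : Prop
    extends IsPeriodicRegular A ω v where
  le : ∀ t, deriv v t + A ⟨v t, mem_domain t⟩ ≤ F t (v t) (v (t - τ))

/-- `w` is an `ω`-periodic upper solution of `u'(t) + A u(t) = F(t, u(t), u(t - τ))`. -/
structure IsUpperSolution (A : E →ₗ.[ℝ] E) (F : ℝ → E → E → E) (ω τ : ℝ) (w : ℝ → E) : Prop
    extends IsPeriodicRegular A ω w where
  ge : ∀ t, F t (w t) (w (t - τ)) ≤ deriv w t + A ⟨w t, mem_domain t⟩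

end DelayEvolution

end

open DelayEvolution

open Set Filter Topology MeasureTheory
open scoped ENNReal

noncomputable section

/-! Adding `C • u` to both sides of the equation replaces `T` by the exponentially stable `S(t) =
e^{-Ct} T(t)`. Then `I - S(ω)` is inverted by a Neumann series, whose terms are positive, and the
periodic mild solutions are exactly the continuous periodic fixed points of `Q` (`IsMild.rescaled`,
`isMild_periodicSolution`, `IsMild.eq_periodicSolution`). The same shift makes the nonlinearity
increasing on `[v₀, w₀]` (`shiftedNonlinearity_mono`), so `Q` is increasing, `v₀ ≤ Q v₀` and `Q w₀ ≤
w₀`, and both iterations are monotone.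

Convergence comes from noncompactness. If `k` is the supremum over `t` of the measure of
noncompactness of the iterates at time `t`, then `k ≤ 4 c ω C_S M_S k`: one factor 2 is the cost of
integrating (`kuratowski_range_integral_le`), the other comes from the present and delayed terms.
Hence `k = 0`. Normality of the cone turns pointwise relative compactness of a monotone sequence
into pointwise convergence and, once the limit is known to be continuous, into uniform convergence
by a Dini argument. The limits are fixed points of `Q`, and any other fixed point in the interval
stays between the two iterations. -/

namespace DelayEvolution

/-! ### Semigroups, mild solutions and the linear periodic problem. -/

section Semigroup

variable {E : Type*} [NormedAddCommGroup E] [NormedSpace ℝ E]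

/-- Joint continuity of `(t, x) ↦ S t x` on `[0, ∞) × E`. -/
def IsJointlyContinuous (S : ℝ → E →L[ℝ] E) : Prop :=
  Continuous fun p : ℝ × E => S (max p.1 0) p.2

theorem IsC0Semigroup.rescaled {T : ℝ → E →L[ℝ] E} (hT : IsC0Semigroup T) (C : ℝ) :
    IsC0Semigroup (rescaled C T) where
  map_zero := by simp [DelayEvolution.rescaled, hT.map_zero]
  map_add s t hs ht := by
    simp only [DelayEvolution.rescaled, hT.map_add s t hs ht, smul_mul_smul_comm, ← Real.exp_add]
    congr 2
    ring
  strong_cont x := by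
    have h : Tendsto (fun t : ℝ => Real.exp (-C * t)) (𝓝[>] 0) (𝓝 1) := by
      have : Continuous fun t : ℝ => Real.exp (-C * t) := by fun_prop
      simpa using (this.tendsto 0).mono_left nhdsWithin_le_nhds
    simpa [DelayEvolution.rescaled] using h.smul (hT.strong_cont x)

theorem rescaled_neg_rescaled (T : ℝ → E →L[ℝ] E) (C : ℝ) :
    rescaled (-C) (rescaled C T) = T := by
  funext t
  simp [rescaled, smul_smul, ← Real.exp_add]

theorem IsJointlyContinuous.rescaled {T : ℝ → E →L[ℝ] E} (hT : IsJointlyContinuous T) (C : ℝ) :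
    IsJointlyContinuous (rescaled C T) := by
  unfold IsJointlyContinuous at *
  exact (Real.continuous_exp.comp (continuous_const.mul
    (continuous_fst.max continuous_const))).smul hT

theorem exists_norm_rescaled_le {T : ℝ → E →L[ℝ] E} {C : ℝ}
    (hC : growthExponent T < (C : EReal)) :
    ∃ M δ : ℝ, 1 ≤ M ∧ 0 < δ ∧ ∀ t, 0 ≤ t → ‖rescaled C T t‖ ≤ M * Real.exp (-δ * t) := by
  obtain ⟨a, ⟨ν, rfl, M, hM, hb⟩, ha⟩ := sInf_lt_iff.1 hC
  refine ⟨M, C - ν, hM, sub_pos.2 (EReal.coe_lt_coe_iff.1 ha), fun t ht => ?_⟩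
  have e : Real.exp (-(C - ν) * t) = Real.exp (-C * t) * Real.exp (ν * t) := by
    rw [← Real.exp_add]; congr 1; ring
  rw [rescaled, norm_smul, Real.norm_eq_abs, Real.abs_exp, e]
  have := mul_le_mul_of_nonneg_left (hb t ht) (Real.exp_pos (-C * t)).le
  linarith

/-- Factoring out `S (min s t)` bounds `‖S t x - S s x‖` by `M * ‖S |t - s| x - x‖`, so strong
continuity at `0` suffices; the uniform bound handles the variation of `x`. -/
theorem IsC0Semigroup.isJointlyContinuous {S : ℝ → E →L[ℝ] E} (hS : IsC0Semigroup S) {M : ℝ}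
    (hM : ∀ t, 0 ≤ t → ‖S t‖ ≤ M) : IsJointlyContinuous S := by
  have hM0 : 0 ≤ M := (norm_nonneg _).trans (hM 0 le_rfl)
  have hz : ∀ x : E, Tendsto (fun t : ℝ => S |t| x) (𝓝 0) (𝓝 x) := fun x => by
    have h0 : Tendsto (fun t => S t x) (𝓝[≥] 0) (𝓝 x) := by
      have : ContinuousWithinAt (fun t => S t x) (Ioi 0) 0 := by
        simpa [ContinuousWithinAt, hS.map_zero] using hS.strong_cont x
      have := continuousWithinAt_Ioi_iff_Ici.1 this
      simpa [ContinuousWithinAt, hS.map_zero] using this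
    refine h0.comp (tendsto_nhdsWithin_iff.2 ⟨?_, Eventually.of_forall fun t => abs_nonneg t⟩)
    simpa using (continuous_abs.tendsto (0 : ℝ))
  have hd : ∀ (x : E) (s t : ℝ), 0 ≤ s → s ≤ t → ‖S t x - S s x‖ ≤ M * ‖S |t - s| x - x‖ := by
    intro x s t hs hst
    have e : S t = S s * S (t - s) := by rw [← hS.map_add s _ hs (sub_nonneg.2 hst)]; simp
    rw [e, abs_of_nonneg (sub_nonneg.2 hst), mul_apply_eq_comp, ← map_sub]
    exact (S s).le_of_opNorm_le (hM s hs) _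
  have hd' : ∀ (x : E) (s t : ℝ), 0 ≤ s → 0 ≤ t → ‖S t x - S s x‖ ≤ M * ‖S |t - s| x - x‖ := by
    intro x s t hs ht
    rcases le_total s t with h | h
    · exact hd x s t hs h
    · rw [norm_sub_rev, abs_sub_comm]
      exact hd x t s ht h
  refine continuous_iff_continuousAt.2 fun ⟨t₀, x₀⟩ => ?_
  refine tendsto_iff_norm_sub_tendsto_zero.2 ?_
  have hb : Tendsto (fun p : ℝ × E => M * ‖p.2 - x₀‖ +
      M * ‖S |max p.1 0 - max t₀ 0| x₀ - x₀‖) (𝓝 (t₀, x₀)) (𝓝 0) := by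
    have h1 : Tendsto (fun p : ℝ × E => max p.1 0 - max t₀ 0) (𝓝 (t₀, x₀)) (𝓝 0) := by
      have : Continuous fun p : ℝ × E => max p.1 0 - max t₀ 0 := by fun_prop
      simpa using this.tendsto (t₀, x₀)
    have h2 := ((((hz x₀).comp h1).sub_const x₀).norm).const_mul M
    have h3 : Tendsto (fun p : ℝ × E => M * ‖p.2 - x₀‖) (𝓝 (t₀, x₀)) (𝓝 0) := by
      have : Continuous fun p : ℝ × E => M * ‖p.2 - x₀‖ := by fun_prop
      simpa using this.tendsto (t₀, x₀)
    simpa using h3.add h2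
  refine squeeze_zero (fun _ => norm_nonneg _) (fun p => ?_) hb
  have e : S (max p.1 0) p.2 - S (max t₀ 0) x₀ =
      S (max p.1 0) (p.2 - x₀) + (S (max p.1 0) x₀ - S (max t₀ 0) x₀) := by
    rw [map_sub]; abel
  dsimp only
  rw [e]
  exact (norm_add_le _ _).trans (add_le_add
    ((S _).le_of_opNorm_le (hM _ (le_max_right _ _)) _)
    (hd' x₀ _ _ (le_max_right _ _) (le_max_right _ _)))

theorem IsJointlyContinuous.continuousOn {S : ℝ → E →L[ℝ] E} (hS : IsJointlyContinuous S)
    {f : ℝ → E} (hf : Continuous f) (t : ℝ) :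
    ContinuousOn (fun r => S (t - r) (f r)) (Iic t) := by
  have : Continuous fun r => S (max (t - r) 0) (f r) :=
    hS.comp ((continuous_const.sub continuous_id).prodMk hf)
  refine this.continuousOn.congr fun r hr => ?_
  simp only [mem_Iic] at hr
  simp [max_eq_left (sub_nonneg.2 hr)]

theorem IsJointlyContinuous.intervalIntegrable {S : ℝ → E →L[ℝ] E} (hS : IsJointlyContinuous S)
    {f : ℝ → E} (hf : Continuous f) {a b t : ℝ} (ha : a ≤ t) (hb : b ≤ t) :
    IntervalIntegrable (fun r => S (t - r) (f r)) volume a b :=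
  ((hS.continuousOn hf t).mono fun _ hr => hr.2.trans (max_le ha hb)).intervalIntegrable

/-- Since `S ω ^ n = S (n * ω)`, exponential decay makes the Neumann series converge absolutely. The
series itself is recorded because positivity of the inverse is read off its terms. -/
theorem isUnit_one_sub [CompleteSpace E] {S : ℝ → E →L[ℝ] E} (hS : IsC0Semigroup S)
    {M δ ω : ℝ} (hδ : 0 < δ) (hω : 0 < ω)
    (hM : ∀ t, 0 ≤ t → ‖S t‖ ≤ M * Real.exp (-δ * t)) :
    IsUnit (1 - S ω) ∧ HasSum (fun n => S ω ^ n) (Ring.inverse (1 - S ω)) := by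
  have hpow : ∀ n : ℕ, S ω ^ n = S (n * ω) := fun n => by
    induction n with
    | zero => simp [hS.map_zero]
    | succ n ih =>
      rw [pow_succ, ih, ← hS.map_add _ _ (by positivity) hω.le]
      congr 1; push_cast; ring
  have hsum : Summable (fun n : ℕ => S ω ^ n) := by
    refine Summable.of_norm_bounded (g := fun n : ℕ => M * Real.exp (-δ * ω) ^ n)
      (Summable.mul_left _ (summable_geometric_of_lt_one (Real.exp_pos _).le ?_)) fun n => ?_
    · rw [Real.exp_lt_one_iff]; nlinarith
    · rw [hpow, ← Real.exp_nat_mul]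
      refine (hM _ (by positivity)).trans_eq ?_
      congr 2; ring
  have h1 := hsum.one_sub_mul_tsum_pow
  have h2 := hsum.tsum_pow_mul_one_sub
  let U : (E →L[ℝ] E)ˣ := ⟨1 - S ω, ∑' n, S ω ^ n, h1, h2⟩
  refine ⟨⟨U, rfl⟩, ?_⟩
  have : Ring.inverse (1 - S ω) = ∑' n, S ω ^ n := Ring.inverse_unit U
  rw [this]
  exact hsum.hasSum

/-- `u` satisfies the variation of constants formula with semigroup `S` and inhomogeneity `f`. -/
def IsMild (S : ℝ → E →L[ℝ] E) (f u : ℝ → E) : Prop :=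
  ∀ s t : ℝ, s ≤ t → u t = S (t - s) (u s) + ∫ r in s..t, S (t - r) (f r)

/-- The `ω`-periodic mild solution with `ω`-periodic inhomogeneity `f`. -/
def periodicSolution (S : ℝ → E →L[ℝ] E) (ω : ℝ) (f : ℝ → E) (t : ℝ) : E :=
  Ring.inverse (1 - S ω) (∫ s in (t - ω)..t, S (t - s) (f s))

theorem IsMild.eq_periodicSolution {S : ℝ → E →L[ℝ] E} {ω : ℝ} (hω : 0 ≤ ω)
    (hunit : IsUnit (1 - S ω)) {f u : ℝ → E} (h : IsMild S f u) (hper : Function.Periodic u ω)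
    (t : ℝ) : u t = periodicSolution S ω f t := by
  have h1 := h (t - ω) t (by linarith)
  rw [hper.sub_eq, sub_sub_cancel] at h1
  have h2 : ∫ r in (t - ω)..t, S (t - r) (f r) = (1 - S ω) (u t) := by
    rw [sub_apply, one_apply_eq_self]
    exact (sub_eq_of_eq_add' h1).symm
  rw [periodicSolution, h2, ← mul_apply_eq_comp, Ring.inverse_mul_cancel _ hunit,
    one_apply_eq_self]

/-- Moves `t` out of the limits and the kernel into the argument of `f`; the clamp `max r 0` makes
the integrand continuous on all of `ℝ` when `f` is continuous and `S` jointly continuous. -/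
theorem integral_convolution_eq (S : ℝ → E →L[ℝ] E) {ω : ℝ} (hω : 0 ≤ ω) (f : ℝ → E) (t : ℝ) :
    ∫ s in (t - ω)..t, S (t - s) (f s) = ∫ r in (0 : ℝ)..ω, S (max r 0) (f (t - r)) := by
  have := intervalIntegral.integral_comp_sub_left (a := 0) (b := ω)
    (fun s => S (t - s) (f s)) t
  rw [sub_zero] at this
  rw [← this]
  refine intervalIntegral.integral_congr fun r hr => ?_
  rw [uIcc_of_le hω] at hr
  simp [max_eq_left hr.1]

theorem continuous_periodicSolution {S : ℝ → E →L[ℝ] E} (hSj : IsJointlyContinuous S)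
    {ω : ℝ} (hω : 0 ≤ ω) {f : ℝ → E} (hf : Continuous f) :
    Continuous (periodicSolution S ω f) := by
  have : Continuous fun t => ∫ r in (0 : ℝ)..ω, S (max r 0) (f (t - r)) := by
    refine intervalIntegral.continuous_parametric_intervalIntegral_of_continuous' ?_ _ _
    exact hSj.comp (continuous_snd.prodMk (hf.comp (continuous_fst.sub continuous_snd)))
  have e : periodicSolution S ω f =
      fun t => Ring.inverse (1 - S ω) (∫ r in (0 : ℝ)..ω, S (max r 0) (f (t - r))) := by
    funext t; rw [periodicSolution, integral_convolution_eq S hω]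
  rw [e]
  exact (Ring.inverse (1 - S ω)).continuous.comp this

theorem periodic_periodicSolution {S : ℝ → E →L[ℝ] E} {ω : ℝ} (hω : 0 ≤ ω) {f : ℝ → E}
    (hper : Function.Periodic f ω) : Function.Periodic (periodicSolution S ω f) ω := fun t => by
  simp only [periodicSolution, integral_convolution_eq S hω]
  congr 1
  refine intervalIntegral.integral_congr fun r _ => ?_
  simp only [show t + ω - r = t - r + ω by ring, hper (t - r)]

variable [CompleteSpace E]

/-- A mild `u` need not be differentiable, but for fixed `t` the curve `r ↦ T (t - r) (u r)` equals
the `C¹` function `ψ` on `[s, t]`. Integrating the derivative of `e^{-C(t-r)} ψ(r)` gives the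
formula. -/
theorem IsMild.rescaled {T : ℝ → E →L[ℝ] E} (hT : IsC0Semigroup T) (hTj : IsJointlyContinuous T)
    {f u : ℝ → E} (hf : Continuous f) (h : IsMild T f u) (C : ℝ) :
    IsMild (rescaled C T) (fun t => f t + C • u t) u := by
  intro s t hst
  set k : ℝ → E := fun q => T (max (t - q) 0) (f q) with hk
  have hkc : Continuous k := hTj.comp ((continuous_const.sub continuous_id).prodMk hf)
  set ψ : ℝ → E := fun r => T (t - s) (u s) + ∫ q in s..r, k q with hψ
  have hψT : ∀ r ∈ Icc s t, T (t - r) (u r) = ψ r := by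
    intro r hr
    rw [h s r hr.1, map_add, ← mul_apply_eq_comp,
      ← hT.map_add _ _ (sub_nonneg.2 hr.2) (sub_nonneg.2 hr.1), hψ,
      ← ContinuousLinearMap.intervalIntegral_comp_comm _ (hTj.intervalIntegrable hf hr.1 le_rfl)]
    congr 1
    · congr 2; ring
    · refine intervalIntegral.integral_congr fun q hq => ?_
      rw [uIcc_of_le hr.1] at hq
      simp only [hk]
      rw [← mul_apply_eq_comp,
        ← hT.map_add _ _ (sub_nonneg.2 hr.2) (sub_nonneg.2 hq.2),
        max_eq_left (by linarith [hq.2, hr.2])]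
      congr 2; ring
  have hψd : ∀ r, HasDerivAt ψ (k r) r := fun r =>
    (intervalIntegral.integral_hasDerivAt_right (hkc.intervalIntegrable _ _)
      hkc.stronglyMeasurable.stronglyMeasurableAtFilter hkc.continuousAt).const_add _
  have hed : ∀ r, HasDerivAt (fun r => Real.exp (-C * (t - r))) (Real.exp (-C * (t - r)) * C) r := by
    intro r
    have h1 : HasDerivAt (fun r => -C * (t - r)) C r := by
      simpa using ((hasDerivAt_id r).const_sub t).const_mul (-C)
    exact h1.exp
  have hprod := fun r => (hed r).smul (hψd r)
  have hψc : Continuous ψ := continuous_iff_continuousAt.2 fun r => (hψd r).continuousAt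
  have ftc := intervalIntegral.integral_eq_sub_of_hasDerivAt (a := s) (b := t)
    (fun r _ => hprod r) (Continuous.intervalIntegrable (by fun_prop) _ _)
  have hcongr : ∫ r in s..t, DelayEvolution.rescaled C T (t - r) (f r + C • u r) =
      ∫ r in s..t, (Real.exp (-C * (t - r)) • k r + (Real.exp (-C * (t - r)) * C) • ψ r) := by
    refine intervalIntegral.integral_congr fun r hr => ?_
    rw [uIcc_of_le hst] at hr
    simp only [DelayEvolution.rescaled, smul_apply, map_add, map_smul,
      hψT r hr, hk, max_eq_left (sub_nonneg.2 hr.2), smul_smul]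
    rw [mul_comm C]
  rw [hcongr, ftc]
  have e1 : ψ t = u t := by
    rw [← hψT t ⟨hst, le_rfl⟩]; simp [hT.map_zero]
  have e2 : ψ s = T (t - s) (u s) := by simp [hψ]
  simp [e1, e2, DelayEvolution.rescaled]

/-- Up to the factor `R`, which commutes with the semigroup, the claim compares integrals of `S (t -
r) (f r)`: those over `[t-ω, t]` and `[s-ω, s]` differ as those over `[s, t]` and `[s-ω, t-ω]`, and
by periodicity the last one is `S ω` applied to the one over `[s, t]`. -/
theorem isMild_periodicSolution {S : ℝ → E →L[ℝ] E} (hS : IsC0Semigroup S)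
    (hSj : IsJointlyContinuous S) {ω : ℝ} (hω : 0 ≤ ω) (hunit : IsUnit (1 - S ω)) {f : ℝ → E}
    (hf : Continuous f) (hper : Function.Periodic f ω) :
    IsMild S f (periodicSolution S ω f) := by
  intro s t hst
  set R := Ring.inverse (1 - S ω) with hR
  have hcomm : ∀ r, 0 ≤ r → Commute (S r) R := fun r hr => by
    have h1 : Commute (S r) (1 - S ω) := by
      refine (Commute.one_right _).sub_right ?_
      rw [Commute, SemiconjBy, ← hS.map_add _ _ hr hω, ← hS.map_add _ _ hω hr, add_comm]
    obtain ⟨U, hU⟩ := hunit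
    rw [hR, ← hU, Ring.inverse_unit]
    rw [← hU] at h1
    exact h1.units_inv_right
  have hts := sub_nonneg.2 hst
  have key : (∫ r in (t - ω)..t, S (t - r) (f r)) -
      S (t - s) (∫ r in (s - ω)..s, S (s - r) (f r)) =
      (1 - S ω) (∫ r in s..t, S (t - r) (f r)) := by
    have e1 : S (t - s) (∫ r in (s - ω)..s, S (s - r) (f r)) =
        ∫ r in (s - ω)..s, S (t - r) (f r) := by
      rw [← ContinuousLinearMap.intervalIntegral_comp_comm _
        (hSj.intervalIntegrable hf (by linarith) le_rfl)]
      refine intervalIntegral.integral_congr fun r hr => ?_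
      rw [uIcc_of_le (by linarith)] at hr
      rw [← mul_apply_eq_comp, ← hS.map_add _ _ hts (sub_nonneg.2 hr.2)]
      congr 2; ring
    have e2 : S ω (∫ r in s..t, S (t - r) (f r)) = ∫ r in (s - ω)..(t - ω), S (t - r) (f r) := by
      rw [← ContinuousLinearMap.intervalIntegral_comp_comm _
        (hSj.intervalIntegrable hf hst le_rfl),
        ← intervalIntegral.integral_comp_sub_right (fun r => S (t - r) (f r)) ω]
      refine intervalIntegral.integral_congr fun r hr => ?_
      rw [uIcc_of_le hst] at hr
      rw [← mul_apply_eq_comp, ← hS.map_add _ _ hω (sub_nonneg.2 hr.2), hper.sub_eq]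
      congr 2; ring
    rw [e1, sub_apply, one_apply_eq_self, e2]
    have ii : ∀ {a b : ℝ}, a ≤ t → b ≤ t →
        IntervalIntegrable (fun r => S (t - r) (f r)) volume a b :=
      fun ha hb => hSj.intervalIntegrable hf ha hb
    rw [← intervalIntegral.integral_interval_sub_interval_comm' (ii (by linarith) le_rfl)
      (ii (by linarith) hst) (ii (by linarith) (by linarith))]
  have key2 := congrArg R key
  rw [map_sub, ← mul_apply_eq_comp R (1 - S ω), hR, Ring.inverse_mul_cancel _ hunit,
    ← hR, one_apply_eq_self] at key2
  have key3 := (hcomm _ hts).eq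
  rw [← key2, periodicSolution, periodicSolution, ← hR, ← mul_apply_eq_comp,
    ← mul_apply_eq_comp, key3]
  abel

/-- A `C¹` function with values in the domain of the generator is a mild solution. -/
theorem isMild_of_generator {T : ℝ → E →L[ℝ] E} (hT : IsC0Semigroup T)
    (hTj : IsJointlyContinuous T) {v v' g : ℝ → E} (hv : ∀ t, HasDerivAt v (v' t) t)
    (hv' : Continuous v') (hg : Continuous g)
    (hgen : ∀ t, Tendsto (fun h : ℝ => h⁻¹ • (T h (v t) - v t)) (𝓝[>] 0) (𝓝 (-g t))) :
    IsMild T (fun t => v' t + g t) v := by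
  intro s t hst
  have hvc : Continuous v := continuous_iff_continuousAt.2 fun r => (hv r).continuousAt
  have hsum : Continuous fun t => v' t + g t := hv'.add hg
  have ftc := intervalIntegral.integral_eq_sub_of_hasDeriv_right_of_le (a := s) (b := t)
    (f := fun r => T (t - r) (v r)) (f' := fun r => T (t - r) (v' r + g r)) hst
    ((hTj.continuousOn hvc t).mono fun r hr => hr.2) (fun r hr => ?_)
    (hTj.intervalIntegrable hsum hst le_rfl)
  · rw [ftc]; simp [hT.map_zero]
  -- The generator only controls right difference quotients. The slope of `r' ↦ T (t - r') (v r')`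
  -- is `T (t - r')` applied to the slope of `v` minus the quotient of `T (r' - r)` at `v r`; joint
  -- continuity gives the limit.
  · rw [hasDerivWithinAt_iff_tendsto_slope' (by simp)]
    have h1 : Tendsto (slope v r) (𝓝[>] r) (𝓝 (v' r)) :=
      (hasDerivWithinAt_iff_tendsto_slope' (by simp)).1 (hv r).hasDerivWithinAt
    have h2 : Tendsto (fun r' => (r' - r)⁻¹ • (T (r' - r) (v r) - v r)) (𝓝[>] r) (𝓝 (-g r)) := by
      refine (hgen r).comp (tendsto_nhdsWithin_iff.2 ⟨?_, ?_⟩)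
      · have : Continuous fun r' => r' - r := by fun_prop
        simpa using (this.tendsto r).mono_left nhdsWithin_le_nhds
      · filter_upwards [self_mem_nhdsWithin] with r' hr'
        exact sub_pos.2 (mem_Ioi.1 hr')
    have h3 : Tendsto (fun r' => t - r') (𝓝[>] r) (𝓝 (t - r)) := by
      have : Continuous fun r' => t - r' := by fun_prop
      exact (this.tendsto r).mono_left nhdsWithin_le_nhds
    have h4 := (hTj.tendsto (t - r, v' r - -g r)).comp (h3.prodMk_nhds (h1.sub h2))
    simp only [max_eq_left (sub_nonneg.2 hr.2.le), sub_neg_eq_add] at h4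
    refine h4.congr' ?_
    filter_upwards [Ioo_mem_nhdsGT hr.2] with r' hr'
    simp only [Function.comp_apply, max_eq_left (sub_nonneg.2 hr'.2.le), slope, vsub_eq_sub]
    rw [← smul_sub, map_smul]
    have e : T (t - r) = T (t - r') * T (r' - r) := by
      rw [← hT.map_add _ _ (sub_nonneg.2 hr'.2.le) (sub_nonneg.2 hr'.1.le)]; congr 1; ring
    rw [e, mul_apply_eq_comp, ← map_sub]
    congr 2
    abel

end Semigroup

/-! ### Measure of noncompactness and integration. -/

section Kuratowski

theorem kuratowski_le_of_cover {X : Type*} [PseudoEMetricSpace X] {B : Set X} {d : ℝ≥0∞}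
    {𝒞 : Set (Set X)} (hf : 𝒞.Finite) (hB : B ⊆ ⋃₀ 𝒞) (hd : ∀ D ∈ 𝒞, Metric.ediam D ≤ d) :
    kuratowski B ≤ d :=
  sInf_le ⟨𝒞, hf, hB, hd⟩

theorem kuratowski_le_ediam {X : Type*} [PseudoEMetricSpace X] (B : Set X) :
    kuratowski B ≤ Metric.ediam B :=
  kuratowski_le_of_cover (finite_singleton B) (by simp) (by simp)

theorem exists_cover_of_kuratowski_lt {X : Type*} [PseudoEMetricSpace X] {B : Set X} {d : ℝ≥0∞}
    (h : kuratowski B < d) :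
    ∃ 𝒞 : Set (Set X), 𝒞.Finite ∧ B ⊆ ⋃₀ 𝒞 ∧ ∀ D ∈ 𝒞, Metric.ediam D ≤ d := by
  obtain ⟨d', ⟨𝒞, hf, hB, hd'⟩, hlt⟩ := sInf_lt_iff.1 h
  exact ⟨𝒞, hf, hB, fun D hD => (hd' D hD).trans hlt.le⟩

theorem kuratowski_mono {X : Type*} [PseudoEMetricSpace X] {A B : Set X} (h : A ⊆ B) :
    kuratowski A ≤ kuratowski B :=
  sInf_le_sInf fun _ ⟨𝒞, hf, hB, hd⟩ => ⟨𝒞, hf, h.trans hB, hd⟩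

theorem kuratowski_insert_le {X : Type*} [PseudoEMetricSpace X] (x : X) (B : Set X) :
    kuratowski (insert x B) ≤ kuratowski B := by
  refine le_sInf fun d ⟨𝒞, hf, hB, hd⟩ => ?_
  refine kuratowski_le_of_cover (hf.insert {x}) ?_ ?_
  · rw [sUnion_insert]
    exact insert_subset (Or.inl rfl) (hB.trans subset_union_right)
  · rintro D (rfl | hD)
    · simp
    · exact hd D hD

theorem kuratowski_image_le {X Y : Type*} [PseudoEMetricSpace X] [PseudoEMetricSpace Y]
    {K : NNReal} {f : X → Y} (hf : LipschitzWith K f) (B : Set X) :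
    kuratowski (f '' B) ≤ K * kuratowski B := by
  have hne : Nonempty {d | ∃ 𝒞 : Set (Set X), 𝒞.Finite ∧ B ⊆ ⋃₀ 𝒞 ∧ ∀ D ∈ 𝒞, Metric.ediam D ≤ d} :=
    ⟨⟨⊤, {univ}, finite_singleton _, by simp, by simp⟩⟩
  rw [kuratowski.eq_1 B, sInf_eq_iInf', ENNReal.mul_iInf' (by simp) (fun _ => hne)]
  refine le_iInf fun ⟨d, 𝒞, hfin, hB, hd⟩ => ?_
  refine kuratowski_le_of_cover (hfin.image (image f)) ?_ ?_
  · rw [← image_sUnion]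
    exact image_mono hB
  · rintro _ ⟨D, hD, rfl⟩
    exact (hf.ediam_image_le D).trans (mul_le_mul_right (hd D hD) _)

theorem totallyBounded_of_kuratowski_eq_zero {X : Type*} [PseudoEMetricSpace X] {B : Set X}
    (h : kuratowski B = 0) : TotallyBounded B := by
  refine EMetric.totallyBounded_iff.2 fun ε hε => ?_
  obtain ⟨ε', hε', hlt⟩ := exists_between hε
  obtain ⟨𝒞, hfin, hB, hd⟩ := exists_cover_of_kuratowski_lt (h.trans_lt hε')
  rcases isEmpty_or_nonempty X with hX | hX
  · exact ⟨∅, finite_empty, fun x => isEmptyElim x⟩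
  have : ∀ D : Set X, ∃ x, D.Nonempty → x ∈ D := fun D => by
    rcases D.eq_empty_or_nonempty with rfl | ⟨x, hx⟩
    · exact ⟨Classical.arbitrary X, fun h => absurd h not_nonempty_empty⟩
    · exact ⟨x, fun _ => hx⟩
  choose c hc using this
  refine ⟨c '' 𝒞, hfin.image c, fun x hx => ?_⟩
  obtain ⟨D, hD, hxD⟩ := hB hx
  refine mem_iUnion₂.2 ⟨c D, mem_image_of_mem c hD, ?_⟩
  exact (Metric.edist_le_of_ediam_le hxD (hc D ⟨x, hxD⟩) (hd D hD)).trans_lt hlt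

variable {E : Type*} [NormedAddCommGroup E] [NormedSpace ℝ E]

theorem infEDist_eq_enorm_mkQ (V : Submodule ℝ E) (x : E) :
    Metric.infEDist x (V : Set E) = ‖(Submodule.Quotient.mk x : E ⧸ V)‖ₑ := by
  have h : ‖(Submodule.Quotient.mk x : E ⧸ V)‖ = Metric.infDist x (V : Set E) :=
    QuotientAddGroup.norm_mk (S := V.toAddSubgroup) x
  rw [← ofReal_norm, h, Metric.infDist, ENNReal.ofReal_toReal]
  exact Metric.infEDist_ne_top ⟨0, V.zero_mem⟩

/-- Distance to `V` is the norm in `E ⧸ V`, and the quotient map commutes with the integral. -/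
theorem infEDist_integral_le [CompleteSpace E] {α : Type*} [MeasurableSpace α] {μ : Measure α}
    (V : Submodule ℝ E) [hV : IsClosed (V : Set E)] {g : α → E} (hg : Integrable g μ) :
    Metric.infEDist (∫ s, g s ∂μ) (V : Set E) ≤ ∫⁻ s, Metric.infEDist (g s) (V : Set E) ∂μ := by
  let L : E →L[ℝ] E ⧸ V := V.mkQ.mkContinuous 1 fun x => by
    rw [one_mul]; exact Submodule.Quotient.norm_mk_le V x
  have h : Submodule.Quotient.mk (∫ s, g s ∂μ) = ∫ s, L (g s) ∂μ :=
    (L.integral_comp_comm hg).symm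
  simp only [infEDist_eq_enorm_mkQ]
  rw [h]
  exact enorm_integral_le_lintegral_enorm _

/-- If a sequence stays within `ρ` of a finite-dimensional subspace and is bounded, its measure of
noncompactness is at most `2ρ`. -/
theorem kuratowski_range_le_of_infEDist_lt (V : Submodule ℝ E) [FiniteDimensional ℝ V]
    {z : ℕ → E} {R : ℝ} (hR : ∀ n, ‖z n‖ ≤ R) {ρ : NNReal}
    (h : ∀ n, Metric.infEDist (z n) (V : Set E) < ρ) {ε : NNReal} (hε : 0 < ε) :
    kuratowski (range z) ≤ 2 * (ρ + ε : ℝ≥0∞) := by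
  have : ∀ n, ∃ y : V, edist (z n) y < ρ := fun n => by
    obtain ⟨y, hy, hlt⟩ := Metric.infEDist_lt_iff.1 (h n)
    exact ⟨⟨y, hy⟩, hlt⟩
  choose y hy using this
  have hyR : ∀ n, y n ∈ Metric.closedBall (0 : V) (R + ρ) := fun n => by
    rw [mem_closedBall_zero_iff]
    have h1 : ‖(y n : E)‖ ≤ ‖z n‖ + ‖z n - y n‖ := by
      rw [norm_sub_rev]; exact norm_le_norm_add_norm_sub' _ _
    have h2 : ‖z n - y n‖ ≤ ρ := by
      have := hy n
      rw [edist_nndist] at this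
      have := NNReal.coe_le_coe.2 (ENNReal.coe_lt_coe.1 this).le
      rwa [coe_nndist, dist_eq_norm] at this
    exact h1.trans (add_le_add (hR n) h2)
  have : ProperSpace V := FiniteDimensional.proper ℝ V
  -- The nearby points `y n` lie in a compact ball of `V`; a finite `ε`-net there gives balls of
  -- radius `ρ + ε` covering the sequence.
  obtain ⟨t, htf, ht⟩ := EMetric.totallyBounded_iff.1
    (isCompact_closedBall (0 : V) (R + ρ)).totallyBounded ε (by simpa using hε)
  refine kuratowski_le_of_cover (htf.image fun c : V => Metric.closedEBall (c : E) (ρ + ε)) ?_ ?_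
  · rintro _ ⟨n, rfl⟩
    obtain ⟨c, hc, hyc⟩ := mem_iUnion₂.1 (ht (hyR n))
    refine ⟨_, mem_image_of_mem _ hc, ?_⟩
    have hyc' : edist (y n : E) c < ε := hyc
    exact (edist_triangle _ (y n : E) _).trans (add_le_add (hy n).le hyc'.le)
  · rintro _ ⟨c, _, rfl⟩
    exact Metric.ediam_closedEBall_le

/-- For a sequence of continuous functions whose values have pointwise measure of noncompactness at
most `β`, the integrals have measure of noncompactness at most `2 (b - a) β`. -/
theorem kuratowski_range_integral_le [CompleteSpace E] {g : ℕ → ℝ → E}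
    (hg : ∀ n, Continuous (g n)) {a b K : ℝ} (hab : a ≤ b)
    (hK : ∀ n, ∀ s ∈ Icc a b, ‖g n s‖ ≤ K) {β : NNReal}
    (hβ : ∀ s ∈ Icc a b, kuratowski (range fun n => g n s) ≤ β) :
    kuratowski (range fun n => ∫ s in a..b, g n s) ≤ 2 * (ENNReal.ofReal (b - a) * β) := by
  -- The points `x i` run through all values `g n q` at rational times, and `V m` is spanned by the
  -- first `m + 1` of them. The worst distance `D m s` of the values `g n s` to `V m` decreases in
  -- `m`.
  obtain ⟨e, he⟩ := exists_surjective_nat (ℕ × ℚ)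
  set x : ℕ → E := fun i => g (e i).1 ((e i).2 : ℝ) with hx
  let V : ℕ → Submodule ℝ E := fun m => Submodule.span ℝ (x '' Iic m)
  have hVfin : ∀ m, FiniteDimensional ℝ (V m) := fun m =>
    FiniteDimensional.span_of_finite ℝ ((finite_Iic m).image x)
  have hVcl : ∀ m, IsClosed (V m : Set E) := fun m => (V m).closed_of_finiteDimensional
  have hVmono : Monotone V := fun m m' h => Submodule.span_mono (image_mono (Iic_subset_Iic.2 h))
  let D : ℕ → ℝ → ℝ≥0∞ := fun m s => ⨆ n, Metric.infEDist (g n s) (V m : Set E)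
  have hDmeas : ∀ m, Measurable (D m) := fun m =>
    Measurable.iSup fun n => (Metric.continuous_infEDist.comp (hg n)).measurable
  have hDanti : Antitone D := fun m m' h s =>
    iSup_mono fun n => Metric.infEDist_anti (hVmono h)
  have hDK : ∀ s ∈ Icc a b, D 0 s ≤ ENNReal.ofReal K := fun s hs => iSup_le fun n => by
    refine (Metric.infEDist_le_edist_of_mem (V 0).zero_mem).trans ?_
    rw [edist_zero_right, ← ofReal_norm]
    exact ENNReal.ofReal_le_ofReal (hK n s hs)
  set μ : Measure ℝ := volume.restrict (Ioc a b) with hμ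
  have hμu : μ univ = ENNReal.ofReal (b - a) := by simp [hμ]
  have hDfin : ∫⁻ s, D 0 s ∂μ ≠ ⊤ := by
    refine ne_top_of_le_ne_top ?_ (setLIntegral_mono measurable_const
      fun s hs => hDK s (Ioc_subset_Icc_self hs))
    simp [ENNReal.mul_eq_top]
  -- Each of the finitely many covering pieces that meets the sequence contains some `g n₀ s`, hence
  -- is close to some `g n₀ q` with `q` rational near `s`. One `V m` contains all these centres.
  have hDinf : ∀ ε : NNReal, 0 < ε → ∀ s ∈ Icc a b, ⨅ m, D m s ≤ β + ε := by
    intro ε hε s hs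
    have hε2 : (0 : ℝ≥0∞) < ε / 2 := by simpa using hε.ne'
    have hlt : kuratowski (range fun n => g n s) < β + ε / 2 :=
      (hβ s hs).trans_lt (ENNReal.lt_add_right ENNReal.coe_ne_top hε2.ne')
    obtain ⟨𝒞, hfin, hB, hd⟩ := exists_cover_of_kuratowski_lt hlt
    have hcentre : ∀ A ∈ 𝒞, ∃ i, ∀ n, g n s ∈ A → edist (g n s) (x i) ≤ β + ε := by
      intro A hA
      by_cases hne : ∃ n, g n s ∈ A
      · obtain ⟨n₀, hn₀⟩ := hne
        have hnhds : ∀ᶠ r in 𝓝 s, edist (g n₀ s) (g n₀ r) < ε / 2 := by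
          have : Tendsto (fun r => edist (g n₀ s) (g n₀ r)) (𝓝 s) (𝓝 0) := by
            have hc : Continuous fun r => edist (g n₀ s) (g n₀ r) :=
              continuous_const.edist (hg n₀)
            simpa using hc.tendsto s
          exact this.eventually_lt_const hε2
        obtain ⟨q, hq⟩ := Rat.isDenseEmbedding_coe_real.dense.exists_mem_open
          isOpen_interior (nonempty_of_mem (mem_interior_iff_mem_nhds.2 hnhds))
        obtain ⟨i, hi⟩ := he (n₀, q)
        refine ⟨i, fun n hn => ?_⟩
        have hxi : x i = g n₀ q := by simp [hx, hi]
        have hq' : (q : ℝ) ∈ {r | edist (g n₀ s) (g n₀ r) < ε / 2} := interior_subset hq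
        rw [hxi]
        calc edist (g n s) (g n₀ q) ≤ edist (g n s) (g n₀ s) + edist (g n₀ s) (g n₀ q) :=
              edist_triangle _ _ _
          _ ≤ (β + ε / 2) + ε / 2 :=
              add_le_add (Metric.edist_le_of_ediam_le hn hn₀ (hd A hA)) (le_of_lt hq')
          _ = β + ε := by rw [add_assoc, ENNReal.add_halves]
      · exact ⟨0, fun n hn => absurd ⟨n, hn⟩ hne⟩
    choose! i hi using hcentre
    obtain ⟨m, hm⟩ := (hfin.image i).bddAbove
    refine (iInf_le _ m).trans (iSup_le fun n => ?_)
    obtain ⟨A, hA, hnA⟩ := hB (mem_range_self n)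
    refine (Metric.infEDist_le_edist_of_mem ?_).trans (hi A hA n hnA)
    exact Submodule.subset_span (mem_image_of_mem x (hm (mem_image_of_mem i hA)))
  have hbound : ∀ n, ‖∫ s in a..b, g n s‖ ≤ K * |b - a| := fun n =>
    intervalIntegral.norm_integral_le_of_norm_le_const fun s hs =>
      hK n s (by rw [uIoc_of_le hab] at hs; exact Ioc_subset_Icc_self hs)
  have main : ∀ ε : NNReal, 0 < ε → kuratowski (range fun n => ∫ s in a..b, g n s) ≤
      ((2 * ((β + ε) * Real.toNNReal (b - a) + ε + ε) : NNReal) : ℝ≥0∞) := by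
    intro ε hε
    -- Monotone convergence; as the supremum over `n` is inside `D`, a single `m` then serves all
    -- the integrals.
    have h1 : ⨅ m, ∫⁻ s, D m s ∂μ ≤ (β + ε) * ENNReal.ofReal (b - a) := by
      rw [← lintegral_iInf hDmeas hDanti hDfin, ← hμu, ← lintegral_const]
      exact setLIntegral_mono measurable_const fun s hs =>
        hDinf ε hε s (Ioc_subset_Icc_self hs)
    have h2 : ⨅ m, ∫⁻ s, D m s ∂μ < (β + ε) * ENNReal.ofReal (b - a) + ε :=
      h1.trans_lt (ENNReal.lt_add_right
        (ENNReal.mul_ne_top (by simp) ENNReal.ofReal_ne_top) (by simpa using hε.ne'))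
    obtain ⟨m, hm⟩ := iInf_lt_iff.1 h2
    have h3 : ∀ n, Metric.infEDist (∫ s in a..b, g n s) (V m : Set E) <
        (((β + ε) * Real.toNNReal (b - a) + ε : NNReal) : ℝ≥0∞) := fun n => by
      have := hVcl m
      rw [intervalIntegral.integral_of_le hab]
      refine (infEDist_integral_le (V m) ((hg n).integrableOn_Ioc)).trans_lt ?_
      refine (lintegral_mono fun s => le_iSup
        (fun n => Metric.infEDist (g n s) (V m : Set E)) n).trans_lt (hm.trans_eq ?_)
      push_cast
      rfl
    have := hVfin m
    refine (kuratowski_range_le_of_infEDist_lt (V m) hbound h3 hε).trans_eq ?_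
    push_cast
    rfl
  have hlim : Tendsto (fun ε : NNReal =>
      ((2 * ((β + ε) * Real.toNNReal (b - a) + ε + ε) : NNReal) : ℝ≥0∞)) (𝓝[>] 0)
      (𝓝 (2 * (ENNReal.ofReal (b - a) * β))) := by
    have hc : Continuous fun ε : NNReal =>
        ((2 * ((β + ε) * Real.toNNReal (b - a) + ε + ε) : NNReal) : ℝ≥0∞) :=
      ENNReal.continuous_coe.comp (by fun_prop)
    have := (hc.tendsto 0).mono_left (nhdsWithin_le_nhds (s := Ioi 0))
    convert this using 2
    simp only [add_zero]
    push_cast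
    rw [mul_comm (ENNReal.ofReal (b - a))]
    rfl
  refine ge_of_tendsto hlim ?_
  filter_upwards [self_mem_nhdsWithin] with ε hε using main ε hε

end Kuratowski

/-! ### Monotone sequences and normal cones. -/

section Order

theorem exists_norm_le_of_periodic {G : Type*} [NormedAddCommGroup G] {f : ℝ → G} {ω : ℝ}
    (hω : 0 < ω) (hf : Continuous f) (hper : Function.Periodic f ω) :
    ∃ K, ∀ t, ‖f t‖ ≤ K := by
  obtain ⟨K, hK⟩ := (isCompact_Icc (a := (0 : ℝ)) (b := ω)).exists_bound_of_continuousOn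
    hf.continuousOn
  refine ⟨K, fun t => ?_⟩
  obtain ⟨y, hy, hty⟩ := hper.exists_mem_Ico₀ hω t
  rw [hty]
  exact hK y (Ico_subset_Icc_self hy)

variable {E : Type*} [NormedAddCommGroup E] [PartialOrder E] [IsOrderedAddMonoid E]
  [OrderClosedTopology E]

/-- In the increasing case `0 ≤ x - z n ≤ x - z m`, so normality lets one good index control all
later ones. -/
theorem norm_sub_le_of_tendsto_subseq {N : ℝ}
    (hN : ∀ x y : E, 0 ≤ x → x ≤ y → ‖x‖ ≤ N * ‖y‖) {z : ℕ → E} (hz : Monotone z ∨ Antitone z)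
    {x : E} {φ : ℕ → ℕ} (hφ : StrictMono φ) (hlim : Tendsto (z ∘ φ) atTop (𝓝 x))
    {m n : ℕ} (hmn : m ≤ n) : ‖x - z n‖ ≤ N * ‖x - z m‖ := by
  rcases hz with hz | hz
  · have hle : z n ≤ x := ge_of_tendsto hlim <| (eventually_ge_atTop n).mono fun j hj =>
      hz (hj.trans hφ.le_apply)
    exact hN _ _ (sub_nonneg.2 hle) (sub_le_sub_left (hz hmn) x)
  · have hle : x ≤ z n := le_of_tendsto hlim <| (eventually_ge_atTop n).mono fun j hj =>
      hz (hj.trans hφ.le_apply)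
    rw [norm_sub_rev x, norm_sub_rev x]
    exact hN _ _ (sub_nonneg.2 hle) (sub_le_sub_right (hz hmn) x)

/-- In a space with normal cone, a monotone sequence with totally bounded range converges. -/
theorem exists_tendsto_of_totallyBounded [CompleteSpace E] {N : ℝ}
    (hN : ∀ x y : E, 0 ≤ x → x ≤ y → ‖x‖ ≤ N * ‖y‖) {z : ℕ → E} (hz : Monotone z ∨ Antitone z)
    (htb : TotallyBounded (range z)) : ∃ x, Tendsto z atTop (𝓝 x) := by
  obtain ⟨x, -, φ, hφ, hlim⟩ := (htb.closure.isCompact_of_isClosed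
    isClosed_closure).tendsto_subseq fun n => subset_closure (mem_range_self n)
  refine ⟨x, Metric.tendsto_atTop.2 fun ε hε => ?_⟩
  have h0 : Tendsto (fun j => N * ‖x - z (φ j)‖) atTop (𝓝 0) := by
    simpa using ((hlim.const_sub x).norm).const_mul N
  obtain ⟨j, hj⟩ := (h0.eventually_lt_const hε).exists
  refine ⟨φ j, fun n hn => ?_⟩
  rw [dist_comm, dist_eq_norm]
  exact (norm_sub_le_of_tendsto_subseq hN hz hφ hlim hn).trans_lt hj

/-- Dini's theorem for periodic functions with values in a space with normal cone. -/
theorem tendstoUniformly_of_periodic {N : ℝ}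
    (hN : ∀ x y : E, 0 ≤ x → x ≤ y → ‖x‖ ≤ N * ‖y‖) {ω : ℝ} (hω : 0 < ω)
    {z : ℕ → ℝ → E} (hz : Monotone z ∨ Antitone z) (hzc : ∀ n, Continuous (z n))
    (hzp : ∀ n, Function.Periodic (z n) ω) {u : ℝ → E} (hu : Continuous u)
    (hup : Function.Periodic u ω) (hlim : ∀ t, Tendsto (fun n => z n t) atTop (𝓝 (u t))) :
    TendstoUniformly z u atTop := by
  have hzt : ∀ t, Monotone (fun n => z n t) ∨ Antitone (fun n => z n t) := fun t =>
    hz.imp (fun h _ _ hmn => h hmn t) (fun h _ _ hmn => h hmn t)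
  have hloc : TendstoLocallyUniformlyOn z u atTop (Icc 0 ω) := by
    refine Metric.tendstoLocallyUniformlyOn_iff.2 fun ε hε x _ => ?_
    have h0 : Tendsto (fun n => N * ‖u x - z n x‖) atTop (𝓝 0) := by
      simpa using (((hlim x).const_sub (u x)).norm).const_mul N
    obtain ⟨m, hm⟩ := (h0.eventually_lt_const hε).exists
    have hc : Continuous fun y => N * ‖u y - z m y‖ :=
      continuous_const.mul (hu.sub (hzc m)).norm
    refine ⟨{y | N * ‖u y - z m y‖ < ε}, mem_nhdsWithin_of_mem_nhds
      (hc.continuousAt.eventually_lt continuousAt_const hm),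
      (eventually_ge_atTop m).mono fun n hn y hy => ?_⟩
    rw [dist_eq_norm]
    exact (norm_sub_le_of_tendsto_subseq hN (hzt y) strictMono_id (hlim y) hn).trans_lt hy
  have hunif := (tendstoLocallyUniformlyOn_iff_tendstoUniformlyOn_of_compact isCompact_Icc).1 hloc
  refine Metric.tendstoUniformly_iff.2 fun ε hε => ?_
  filter_upwards [Metric.tendstoUniformlyOn_iff.1 hunif ε hε] with n hn t
  -- Pairing the functions yields one representative `y` of `t` that works for both.
  have hper : Function.Periodic (fun t => (u t, z n t)) ω := fun t => by
    simp only [hup t, hzp n t]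
  obtain ⟨y, hy, hty⟩ := hper.exists_mem_Ico₀ hω t
  obtain ⟨h1, h2⟩ := Prod.mk.inj hty
  rw [h1, h2]
  exact hn y (Ico_subset_Icc_self hy)

end Order

/-! ### Convergence of monotone iterates. -/

section Iteration

variable {E : Type*} [NormedAddCommGroup E] [NormedSpace ℝ E]

theorem tendsto_periodicSolution {S : ℝ → E →L[ℝ] E} (hSj : IsJointlyContinuous S) {M : ℝ}
    (hM : ∀ t, 0 ≤ t → ‖S t‖ ≤ M) {ω : ℝ} (hω : 0 ≤ ω) {f : ℕ → ℝ → E} {g : ℝ → E}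
    (hf : ∀ n, Continuous (f n)) {K : ℝ} (hK : ∀ n t, ‖f n t‖ ≤ K)
    (hlim : ∀ t, Tendsto (fun n => f n t) atTop (𝓝 (g t))) (t : ℝ) :
    Tendsto (fun n => periodicSolution S ω (f n) t) atTop (𝓝 (periodicSolution S ω g t)) := by
  simp only [periodicSolution, integral_convolution_eq S hω]
  refine ((Ring.inverse (1 - S ω)).continuous.tendsto _).comp ?_
  refine intervalIntegral.tendsto_integral_filter_of_dominated_convergence (fun _ => M * K)
    (Eventually.of_forall fun n => ?_) (Eventually.of_forall fun n => ?_)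
    intervalIntegrable_const (Eventually.of_forall fun r _ => ?_)
  · have : Continuous fun r => S (max r 0) (f n (t - r)) :=
      hSj.comp (continuous_id.prodMk ((hf n).comp (continuous_const.sub continuous_id)))
    exact this.aestronglyMeasurable
  · refine Eventually.of_forall fun r _ => ?_
    exact (S _).le_of_opNorm_le_of_le (hM _ (le_max_right _ _)) (hK n _)
  · exact ((S _).continuous.tendsto _).comp (hlim _)

/-- A function which follows the orbits of a `C₀`-semigroup up to an error proportional to the
elapsed time is continuous. -/
theorem continuous_of_norm_sub_le {S : ℝ → E →L[ℝ] E} (hSj : IsJointlyContinuous S) {L : ℝ}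
    (hL : 0 ≤ L) {u : ℝ → E} (h : ∀ s t, s ≤ t → ‖u t - S (t - s) (u s)‖ ≤ L * (t - s)) :
    Continuous u := by
  refine continuous_iff_continuousAt.2 fun t => Metric.tendsto_nhds.2 fun ε hε => ?_
  -- Both `u t'` and `u t` are compared with the orbit started at `t - a`: the errors are at most `2
  -- * (ε / 4)` and `ε / 4`, leaving `ε / 4` for the motion along the orbit. Using `L + 1` covers `L
  -- = 0`.
  set a := ε / (4 * (L + 1)) with ha
  have ha0 : 0 < a := by positivity
  have haL : L * a ≤ ε / 4 := by
    have : (L + 1) * a = ε / 4 := by rw [ha]; field_simp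
    nlinarith
  have hc : Continuous fun t' => S (max (t' - (t - a)) 0) (u (t - a)) :=
    hSj.comp ((continuous_id.sub continuous_const).prodMk continuous_const)
  have h1 := Metric.tendsto_nhds.1 (hc.tendsto t) (ε / 4) (by positivity)
  filter_upwards [h1, Ioo_mem_nhds (show t - a < t by linarith) (show t < t + a by linarith)]
    with t' ht' hmem
  rw [max_eq_left (by linarith [hmem.1]), max_eq_left (by linarith), dist_eq_norm] at ht'
  have e1 := h (t - a) t' hmem.1.le
  have e2 := h (t - a) t (by linarith)
  rw [norm_sub_rev] at e2
  have e3 : L * (t' - (t - a)) ≤ 2 * (ε / 4) := by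
    have : t' - (t - a) ≤ 2 * a := by linarith [hmem.2]
    nlinarith
  have e4 : L * (t - (t - a)) ≤ ε / 4 := by rwa [sub_sub_cancel]
  rw [dist_eq_norm]
  have e : u t' - u t = (u t' - S (t' - (t - a)) (u (t - a))) +
      (S (t' - (t - a)) (u (t - a)) - S (t - (t - a)) (u (t - a))) +
      (S (t - (t - a)) (u (t - a)) - u t) := by abel
  rw [e]
  calc _ ≤ _ + _ + _ := norm_add₃_le
    _ < ε := by linarith

variable [CompleteSpace E]

/-- Under the noncompactness estimate, the iterates are pointwise relatively compact. -/
theorem kuratowski_range_iterates_eq_zero {S : ℝ → E →L[ℝ] E} (hSj : IsJointlyContinuous S)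
    {M : ℝ} (hM : ∀ t, 0 ≤ t → ‖S t‖ ≤ M) {ω : ℝ} (hω : 0 ≤ ω) {z f : ℕ → ℝ → E}
    (hzf : ∀ n t, z (n + 1) t = periodicSolution S ω (f n) t) (hf : ∀ n, Continuous (f n))
    {K : ℝ} (hK : ∀ n t, ‖f n t‖ ≤ K) {R : ℝ} (hR : ∀ n t, ‖z n t‖ ≤ R) {c : ℝ} (hc : 0 ≤ c)
    {τ : ℝ} (hκ : ∀ t, kuratowski (range fun n => f n t) ≤ ENNReal.ofReal c *
      (kuratowski (range fun n => z n t) + kuratowski (range fun n => z n (t - τ))))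
    (hlt : 4 * c * ω * resolventNorm S ω * M < 1) (t : ℝ) :
    kuratowski (range fun n => z n t) = 0 := by
  have hM0 : 0 ≤ M := (norm_nonneg _).trans (hM 0 le_rfl)
  have hfin : ⨆ t, kuratowski (range fun n => z n t) ≠ ⊤ := by
    refine ne_top_of_le_ne_top (ENNReal.ofReal_ne_top (r := R + R)) (iSup_le fun t => ?_)
    refine (kuratowski_le_ediam _).trans (Metric.ediam_le ?_)
    rintro _ ⟨m, rfl⟩ _ ⟨n, rfl⟩
    rw [edist_dist]
    exact ENNReal.ofReal_le_ofReal
      ((dist_le_norm_add_norm _ _).trans (add_le_add (hR m t) (hR n t)))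
  obtain ⟨k, hk⟩ : ∃ k : NNReal, (k : ℝ≥0∞) = ⨆ t, kuratowski (range fun n => z n t) :=
    ⟨_, ENNReal.coe_toNNReal hfin⟩
  have hkt : ∀ t, kuratowski (range fun n => z n t) ≤ k := fun t => by
    rw [hk]; exact le_iSup (fun t => kuratowski (range fun n => z n t)) t
  set β : NNReal := M.toNNReal * (c.toNNReal * (k + k)) with hβ
  have hstep : ∀ t, kuratowski (range fun n => z n t) ≤
      ((‖Ring.inverse (1 - S ω)‖₊ * (2 * (ω.toNNReal * β)) : NNReal) : ℝ≥0∞) := by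
    intro t
    -- Only the terms from index `1` on are values of the solution operator; adding one point does
    -- not raise the measure of noncompactness.
    have hsub : (range fun n => z n t) ⊆ insert (z 0 t) (range fun n => z (n + 1) t) := by
      rintro _ ⟨n, rfl⟩
      cases n with
      | zero => exact Or.inl rfl
      | succ n => exact Or.inr ⟨n, rfl⟩
    refine (kuratowski_mono hsub).trans ((kuratowski_insert_le _ _).trans ?_)
    have himg : (range fun n => z (n + 1) t) = (Ring.inverse (1 - S ω) : E →L[ℝ] E) ''
        range fun n => ∫ r in (0 : ℝ)..ω, S (max r 0) (f n (t - r)) := by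
      rw [← range_comp]
      congr 1
      funext n
      rw [hzf, periodicSolution, integral_convolution_eq S hω]
      rfl
    rw [himg]
    refine (kuratowski_image_le (Ring.inverse (1 - S ω)).lipschitz _).trans ?_
    rw [ENNReal.coe_mul]
    refine mul_le_mul_right ?_ _
    refine (kuratowski_range_integral_le (β := β) (K := M * K) (fun n => ?_) hω (fun n s _ => ?_)
      fun s _ => ?_).trans_eq ?_
    · exact hSj.comp (continuous_id.prodMk ((hf n).comp (continuous_const.sub continuous_id)))
    · exact (S _).le_of_opNorm_le_of_le (hM _ (le_max_right _ _)) (hK n _)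
    · have himg' : (range fun n => S (max s 0) (f n (t - s))) =
          S (max s 0) '' range fun n => f n (t - s) := by
        rw [← range_comp]; rfl
      rw [himg']
      refine (kuratowski_image_le (S (max s 0)).lipschitz _).trans ?_
      rw [hβ, ENNReal.coe_mul, ENNReal.coe_mul, ENNReal.coe_add]
      refine mul_le_mul' (ENNReal.coe_le_coe.2 ?_) ((hκ _).trans ?_)
      · exact NNReal.le_toNNReal_of_coe_le (hM _ (le_max_right _ _))
      · exact mul_le_mul_right (add_le_add (hkt _) (hkt _)) _
    · rw [sub_zero]; push_cast; rfl
  have hkk : k ≤ ‖Ring.inverse (1 - S ω)‖₊ * (2 * (ω.toNNReal * β)) := by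
    rw [← ENNReal.coe_le_coe, hk]
    exact iSup_le hstep
  -- The estimate reads `k ≤ q k` with `q < 1`, which forces `k = 0` because `k` is finite.
  have hk0 : k = 0 := by
    have h1 : (k : ℝ) ≤ resolventNorm S ω * (2 * (ω * (M * (c * (k + k))))) := by
      have := NNReal.coe_le_coe.2 hkk
      simpa [hβ, resolventNorm, hω, hM0, hc] using this
    have h2 : (0 : ℝ) ≤ k := k.2
    have h3 : (k : ℝ) ≤ (4 * c * ω * resolventNorm S ω * M) * k := by linarith
    have h4 : (k : ℝ) = 0 := by nlinarith
    exact_mod_cast h4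
  have := hkt t
  rw [hk0] at this
  simpa using this

/-- Monotone iterates of the periodic solution operator converge uniformly. -/
theorem exists_tendstoUniformly_iterates [PartialOrder E] [IsOrderedAddMonoid E]
    [OrderClosedTopology E] {N : ℝ} (hN : ∀ x y : E, 0 ≤ x → x ≤ y → ‖x‖ ≤ N * ‖y‖)
    {S : ℝ → E →L[ℝ] E} (hS : IsC0Semigroup S) (hSj : IsJointlyContinuous S)
    {M : ℝ} (hM : ∀ t, 0 ≤ t → ‖S t‖ ≤ M) {ω : ℝ} (hω : 0 < ω) (hunit : IsUnit (1 - S ω))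
    {z f : ℕ → ℝ → E} (hz : Monotone z ∨ Antitone z) (hzc : ∀ n, Continuous (z n))
    (hzp : ∀ n, Function.Periodic (z n) ω)
    (hzf : ∀ n t, z (n + 1) t = periodicSolution S ω (f n) t) (hf : ∀ n, Continuous (f n))
    (hfp : ∀ n, Function.Periodic (f n) ω) {K : ℝ} (hK : ∀ n t, ‖f n t‖ ≤ K)
    {R : ℝ} (hR : ∀ n t, ‖z n t‖ ≤ R) {c : ℝ} (hc : 0 ≤ c)
    {τ : ℝ} (hκ : ∀ t, kuratowski (range fun n => f n t) ≤ ENNReal.ofReal c *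
      (kuratowski (range fun n => z n t) + kuratowski (range fun n => z n (t - τ))))
    (hlt : 4 * c * ω * resolventNorm S ω * M < 1) :
    ∃ u : ℝ → E, Continuous u ∧ Function.Periodic u ω ∧ TendstoUniformly z u atTop := by
  have hM0 : 0 ≤ M := (norm_nonneg _).trans (hM 0 le_rfl)
  have hK0 : 0 ≤ K := (norm_nonneg _).trans (hK 0 0)
  have hpt : ∀ t, ∃ x, Tendsto (fun n => z n t) atTop (𝓝 x) := fun t =>
    exists_tendsto_of_totallyBounded hN
      (hz.imp (fun h _ _ hmn => h hmn t) (fun h _ _ hmn => h hmn t))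
      (totallyBounded_of_kuratowski_eq_zero
        (kuratowski_range_iterates_eq_zero hSj hM hω.le hzf hf hK hR hc hκ hlt t))
  choose u hu using hpt
  have hup : Function.Periodic u ω := fun t =>
    tendsto_nhds_unique (hu (t + ω)) (by simpa only [hzp _ t] using hu t)
  have huc : Continuous u := by
    -- Each iterate from index `1` on is mild, so it follows the orbits of `S` up to `M * K * (t -
    -- s)`; this bound passes to the pointwise limit.
    refine continuous_of_norm_sub_le hSj (mul_nonneg hM0 hK0) fun s t hst => ?_
    have hl : Tendsto (fun n => ‖z (n + 1) t - S (t - s) (z (n + 1) s)‖) atTop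
        (𝓝 ‖u t - S (t - s) (u s)‖) :=
      (((hu t).comp (tendsto_add_atTop_nat 1)).sub
        (((S (t - s)).continuous.tendsto _).comp ((hu s).comp (tendsto_add_atTop_nat 1)))).norm
    refine le_of_tendsto' hl fun n => ?_
    rw [hzf, hzf, isMild_periodicSolution hS hSj hω.le hunit (hf n) (hfp n) s t hst,
      add_sub_cancel_left]
    refine (intervalIntegral.norm_integral_le_of_norm_le_const (C := M * K) fun r hr => ?_).trans_eq
      (by rw [abs_of_nonneg (sub_nonneg.2 hst)])
    rw [uIoc_of_le hst] at hr
    exact (S _).le_of_opNorm_le_of_le (hM _ (sub_nonneg.2 hr.2)) (hK n r)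
  exact ⟨u, huc, hup, tendstoUniformly_of_periodic hN hω hz hzc hzp huc hup hu⟩

end Iteration

/-! ### Positivity of the linear solution operator. -/

section PositiveSemigroup

variable {E : Type*} [NormedAddCommGroup E] [NormedSpace ℝ E] [PartialOrder E]

theorem IsPositiveSemigroup.rescaled [IsOrderedModule ℝ E] {T : ℝ → E →L[ℝ] E}
    (hT : IsPositiveSemigroup T) (C : ℝ) : IsPositiveSemigroup (rescaled C T) :=
  fun t ht x hx => smul_nonneg (Real.exp_pos _).le (hT t ht x hx)

variable [IsOrderedAddMonoid E] [OrderClosedTopology E]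

theorem inverse_one_sub_nonneg {S : ℝ → E →L[ℝ] E} (hpos : IsPositiveSemigroup S) {ω : ℝ}
    (hω : 0 ≤ ω) (hsum : HasSum (fun n => S ω ^ n) (Ring.inverse (1 - S ω))) {x : E}
    (hx : 0 ≤ x) : 0 ≤ (Ring.inverse (1 - S ω) : E →L[ℝ] E) x := by
  have h := hsum.mapL (ContinuousLinearMap.apply ℝ E x)
  refine HasSum.nonneg (fun n => ?_) h
  change 0 ≤ (S ω ^ n) x
  induction n with
  | zero => simpa using hx
  | succ n ih =>
    rw [pow_succ', mul_apply_eq_comp]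
    exact hpos ω hω _ ih

theorem periodicSolution_mono [CompleteSpace E] [IsOrderedModule ℝ E] {S : ℝ → E →L[ℝ] E}
    (hSj : IsJointlyContinuous S) (hpos : IsPositiveSemigroup S) {ω : ℝ} (hω : 0 ≤ ω)
    (hsum : HasSum (fun n => S ω ^ n) (Ring.inverse (1 - S ω))) {f g : ℝ → E}
    (hf : Continuous f) (hg : Continuous g) (hfg : ∀ t, f t ≤ g t) (t : ℝ) :
    periodicSolution S ω f t ≤ periodicSolution S ω g t := by
  have hle : t - ω ≤ t := by linarith
  rw [← sub_nonneg, periodicSolution, periodicSolution, ← map_sub,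
    ← intervalIntegral.integral_sub (hSj.intervalIntegrable hg hle le_rfl)
      (hSj.intervalIntegrable hf hle le_rfl)]
  refine inverse_one_sub_nonneg hpos hω hsum ?_
  rw [intervalIntegral.integral_of_le hle]
  refine integral_nonneg_of_ae ((ae_restrict_iff' measurableSet_Ioc).2
    (Eventually.of_forall fun r hr => ?_))
  change 0 ≤ S (t - r) (g r) - S (t - r) (f r)
  rw [← map_sub]
  exact hpos _ (sub_nonneg.2 hr.2) _ (sub_nonneg.2 (hfg r))

end PositiveSemigroup

/-! ### The shifted nonlinearity and the fixed points of `Q`. -/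

section Shift

variable {E : Type*} [NormedAddCommGroup E] [NormedSpace ℝ E]

/-- The shifted nonlinearity `s ↦ F(s, u(s), u(s - τ)) + C u(s)` along `u`. -/
def shiftedNonlinearity (F : ℝ → E → E → E) (τ C : ℝ) (u : ℝ → E) (s : ℝ) : E :=
  F s (u s) (u (s - τ)) + C • u s

theorem continuous_shiftedNonlinearity {F : ℝ → E → E → E}
    (hF : Continuous fun p : ℝ × E × E => F p.1 p.2.1 p.2.2) (τ C : ℝ) {u : ℝ → E}
    (hu : Continuous u) : Continuous (shiftedNonlinearity F τ C u) :=
  (hF.comp (continuous_id.prodMk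
    (hu.prodMk (hu.comp (continuous_id.sub continuous_const))))).add (hu.const_smul C)

theorem periodic_shiftedNonlinearity {F : ℝ → E → E → E} {ω : ℝ}
    (hFper : ∀ t x y, F (t + ω) x y = F t x y) (τ C : ℝ) {u : ℝ → E}
    (hu : Function.Periodic u ω) : Function.Periodic (shiftedNonlinearity F τ C u) ω := fun t => by
  simp only [shiftedNonlinearity, hFper, hu t, show t + ω - τ = t - τ + ω by ring, hu (t - τ)]

theorem tendsto_shiftedNonlinearity {F : ℝ → E → E → E}
    (hF : Continuous fun p : ℝ × E × E => F p.1 p.2.1 p.2.2) (τ C : ℝ) {z : ℕ → ℝ → E}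
    {u : ℝ → E} (h : ∀ t, Tendsto (fun n => z n t) atTop (𝓝 (u t))) (t : ℝ) :
    Tendsto (fun n => shiftedNonlinearity F τ C (z n) t) atTop
      (𝓝 (shiftedNonlinearity F τ C u t)) :=
  ((hF.tendsto (t, u t, u (t - τ))).comp
    (tendsto_const_nhds.prodMk_nhds ((h t).prodMk_nhds (h (t - τ))))).add ((h t).const_smul C)

/-- `H4` allows a loss of `C₂` times the present increment plus `C₃` times the delayed one. By `H3`
the latter is at most `C₃ / C₁` times the present increment, so `C ≥ C₂ + C₃ / C₁` absorbs both. -/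
theorem shiftedNonlinearity_mono [PartialOrder E] [IsOrderedAddMonoid E] [IsOrderedModule ℝ E]
    {F : ℝ → E → E → E} {ω τ C C₁ C₂ C₃ : ℝ} {v₀ w₀ : ℝ → E} (hC₁ : 0 < C₁)
    (H3 : ∀ u₁ ∈ periodicIcc ω v₀ w₀, ∀ u₂ ∈ periodicIcc ω v₀ w₀, (∀ t, u₁ t ≤ u₂ t) →
      ∀ t, C₁ • (u₂ (t - τ) - u₁ (t - τ)) ≤ u₂ t - u₁ t)
    (hC₃ : 0 ≤ C₃)
    (H4 : ∀ t : ℝ, ∀ x₁ x₂ y₁ y₂ : E, v₀ t ≤ x₁ → x₁ ≤ x₂ → x₂ ≤ w₀ t →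
      v₀ (t - τ) ≤ y₁ → y₁ ≤ y₂ → y₂ ≤ w₀ (t - τ) →
      -(C₂ • (x₂ - x₁)) - C₃ • (y₂ - y₁) ≤ F t x₂ y₂ - F t x₁ y₁)
    (hC : C₂ + C₃ / C₁ ≤ C) {u₁ u₂ : ℝ → E} (h₁ : u₁ ∈ periodicIcc ω v₀ w₀)
    (h₂ : u₂ ∈ periodicIcc ω v₀ w₀) (h : ∀ t, u₁ t ≤ u₂ t) (t : ℝ) :
    shiftedNonlinearity F τ C u₁ t ≤ shiftedNonlinearity F τ C u₂ t := by
  have h4 := H4 t _ _ _ _ (h₁.2.2.1 t) (h t) (h₂.2.2.2 t) (h₁.2.2.1 (t - τ)) (h (t - τ))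
    (h₂.2.2.2 (t - τ))
  have h3 := smul_le_smul_of_nonneg_left (H3 u₁ h₁ u₂ h₂ h t) (div_nonneg hC₃ hC₁.le)
  rw [smul_smul, div_mul_cancel₀ _ hC₁.ne'] at h3
  have h5 : 0 ≤ (C - (C₂ + C₃ / C₁)) • (u₂ t - u₁ t) :=
    smul_nonneg (sub_nonneg.2 hC) (sub_nonneg.2 (h t))
  rw [← sub_nonneg] at h3 h4 ⊢
  have e : shiftedNonlinearity F τ C u₂ t - shiftedNonlinearity F τ C u₁ t =
      (F t (u₂ t) (u₂ (t - τ)) - F t (u₁ t) (u₁ (t - τ)) -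
        (-(C₂ • (u₂ t - u₁ t)) - C₃ • (u₂ (t - τ) - u₁ (t - τ)))) +
      ((C₃ / C₁) • (u₂ t - u₁ t) - C₃ • (u₂ (t - τ) - u₁ (t - τ))) +
      (C - (C₂ + C₃ / C₁)) • (u₂ t - u₁ t) := by
    simp only [shiftedNonlinearity]
    module
  rw [e]
  exact add_nonneg (add_nonneg h4 h3) h5

variable [CompleteSpace E]

/-- A fixed point is mild for `rescaled C T`; rescaling by `-C` restores `T` and cancels the term `C
• u`. -/
theorem isPeriodicMildSolution_of_fixedPoint {T : ℝ → E →L[ℝ] E} (hT : IsC0Semigroup T) {C : ℝ}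
    (hSj : IsJointlyContinuous (rescaled C T)) {F : ℝ → E → E → E}
    (hF : Continuous fun p : ℝ × E × E => F p.1 p.2.1 p.2.2) {ω τ : ℝ} (hω : 0 ≤ ω)
    (hFper : ∀ t x y, F (t + ω) x y = F t x y)
    (hunit : IsUnit (1 - rescaled C T ω)) {u : ℝ → E} (huc : Continuous u)
    (hup : Function.Periodic u ω) (hfix : ∀ t, iterOp T F ω τ C u t = u t) :
    IsPeriodicMildSolution T F ω τ u := by
  refine ⟨huc, hup, ?_⟩
  have hfc := continuous_shiftedNonlinearity hF τ C huc
  have h1 : IsMild (rescaled C T) (shiftedNonlinearity F τ C u) u := by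
    have e : periodicSolution (rescaled C T) ω (shiftedNonlinearity F τ C u) = u := funext hfix
    have := isMild_periodicSolution (hT.rescaled C) hSj hω hunit hfc
      (periodic_shiftedNonlinearity hFper τ C hup)
    rwa [e] at this
  have h2 := h1.rescaled (hT.rescaled C) hSj hfc (-C)
  rw [rescaled_neg_rescaled] at h2
  simpa [IsMild, shiftedNonlinearity] using h2

theorem IsPeriodicMildSolution.iterOp_eq {T : ℝ → E →L[ℝ] E} (hT : IsC0Semigroup T)
    (hTj : IsJointlyContinuous T) {C : ℝ} {F : ℝ → E → E → E}
    (hF : Continuous fun p : ℝ × E × E => F p.1 p.2.1 p.2.2) {ω τ : ℝ} (hω : 0 ≤ ω)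
    (hunit : IsUnit (1 - rescaled C T ω)) {u : ℝ → E} (hu : IsPeriodicMildSolution T F ω τ u)
    (t : ℝ) : iterOp T F ω τ C u t = u t := by
  have hFc : Continuous fun s => F s (u s) (u (s - τ)) :=
    hF.comp (continuous_id.prodMk (hu.continuous.prodMk
      (hu.continuous.comp (continuous_id.sub continuous_const))))
  have h : IsMild T (fun s => F s (u s) (u (s - τ))) u := hu.mild
  exact ((h.rescaled hT hTj hFc C).eq_periodicSolution hω hunit hu.periodic t).symm

/-- A regular periodic function solves the periodic problem with right-hand side `v' + A v`. -/
theorem IsPeriodicRegular.eq_periodicSolution {A : E →ₗ.[ℝ] E} {T : ℝ → E →L[ℝ] E}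
    (hT : IsC0Semigroup T) (hgen : IsGenerator (-A) T) (hTj : IsJointlyContinuous T) {ω : ℝ}
    (hω : 0 ≤ ω) {C : ℝ} (hunit : IsUnit (1 - rescaled C T ω)) {v : ℝ → E}
    (hv : IsPeriodicRegular A ω v) (t : ℝ) :
    v t = periodicSolution (rescaled C T) ω
      (fun t => (deriv v t + A ⟨v t, hv.mem_domain t⟩) + C • v t) t := by
  have hmild := isMild_of_generator hT hTj (v := v) (v' := deriv v)
    (g := fun t => A ⟨v t, hv.mem_domain t⟩)
    (fun t => (hv.contDiff.differentiable (by simp) t).hasDerivAt)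
    (hv.contDiff.continuous_deriv (by simp)) hv.continuous_apply
    (fun t => (hgen _ _).1 ((-A).mem_graph ⟨v t, hv.mem_domain t⟩))
  exact (hmild.rescaled hT hTj ((hv.contDiff.continuous_deriv (by simp)).add hv.continuous_apply)
    C).eq_periodicSolution hω hunit hv.periodic t

end Shift

end DelayEvolution

end

/-! ### The monotone iteration between the lower and upper solutions. -/

open DelayEvolution
theorem theorem3p5 {E : Type*} [NormedAddCommGroup E] [NormedSpace ℝ E] [CompleteSpace E]
    [PartialOrder E] [IsOrderedAddMonoid E] [IsOrderedModule ℝ E] [OrderClosedTopology E]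
    (hnormal : HasNormalCone E)
    (A : E →ₗ.[ℝ] E) (hA : A.IsClosed)
    (T : ℝ → E →L[ℝ] E) (hT : IsC0Semigroup T) (hgen : IsGenerator (-A) T)
    (hpos : IsPositiveSemigroup T) (hequi : IsEquicontinuousSemigroup T)
    (ω τ : ℝ) (hω : 0 < ω) (hτ : 0 < τ)
    (F : ℝ → E → E → E) (hF : Continuous fun p : ℝ × E × E => F p.1 p.2.1 p.2.2)
    (hFper : ∀ t x y, F (t + ω) x y = F t x y)
    (v₀ w₀ : ℝ → E) (hv : IsLowerSolution A F ω τ v₀) (hw : IsUpperSolution A F ω τ w₀)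
    (hvw : ∀ t, v₀ t ≤ w₀ t)
    -- delay comparison condition
    (C₁ : ℝ) (hC₁ : 0 < C₁)
    (H3 : ∀ u₁ ∈ periodicIcc ω v₀ w₀, ∀ u₂ ∈ periodicIcc ω v₀ w₀, (∀ t, u₁ t ≤ u₂ t) →
      ∀ t, C₁ • (u₂ (t - τ) - u₁ (t - τ)) ≤ u₂ t - u₁ t)
    -- quasi-monotonicity of `F`
    (C₂ C₃ : ℝ) (hC₂ : 0 ≤ C₂) (hC₃ : 0 ≤ C₃)
    (H4 : ∀ t : ℝ, ∀ x₁ x₂ y₁ y₂ : E, v₀ t ≤ x₁ → x₁ ≤ x₂ → x₂ ≤ w₀ t →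
      v₀ (t - τ) ≤ y₁ → y₁ ≤ y₂ → y₂ ≤ w₀ (t - τ) →
      -(C₂ • (x₂ - x₁)) - C₃ • (y₂ - y₁) ≤ F t x₂ y₂ - F t x₁ y₁)
    -- the shift `C`, chosen so that `S(t) = e^{-Ct} T(t)` is exponentially stable
    (C : ℝ) (hC : C₂ + C₃ / C₁ ≤ C) (hCν : growthExponent T < (C : EReal))
    -- noncompactness condition on `F`
    (H2 : ∃ c : ℝ, 0 ≤ c ∧
      4 * c * ω * resolventNorm (rescaled C T) ω * supNorm (rescaled C T) < 1 ∧
      ∀ u : ℕ → ℝ → E, (∀ n, u n ∈ periodicIcc ω v₀ w₀) → (Monotone u ∨ Antitone u) → ∀ t : ℝ,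
        kuratowski (Set.range fun n => F t (u n t) (u n (t - τ)) + C • u n t) ≤
          ENNReal.ofReal c *
            (kuratowski (Set.range fun n => u n t) +
              kuratowski (Set.range fun n => u n (t - τ)))) :
    IsUnit (1 - rescaled C T ω) ∧
    ∃ v w : ℕ → ℝ → E,
      -- the iterative sequences starting from `v₀` and `w₀`
      v 0 = v₀ ∧ w 0 = w₀ ∧
      (∀ n, v (n + 1) = iterOp T F ω τ C (v n)) ∧ (∀ n, w (n + 1) = iterOp T F ω τ C (w n)) ∧
      (∀ n, v n ∈ periodicIcc ω v₀ w₀) ∧ (∀ n, w n ∈ periodicIcc ω v₀ w₀) ∧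
      Monotone v ∧ Antitone w ∧ (∀ n, v n ≤ w n) ∧
      -- their limits are the minimal and the maximal mild solution
      ∃ umin ∈ periodicIcc ω v₀ w₀, ∃ umax ∈ periodicIcc ω v₀ w₀,
        TendstoUniformly v umin atTop ∧ TendstoUniformly w umax atTop ∧
        IsPeriodicMildSolution T F ω τ umin ∧ IsPeriodicMildSolution T F ω τ umax ∧
        ∀ u ∈ periodicIcc ω v₀ w₀, IsPeriodicMildSolution T F ω τ u →
          ∀ t, umin t ≤ u t ∧ u t ≤ umax t := by
  obtain ⟨N, -, hN⟩ := hnormal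
  obtain ⟨c, hc, hlt, hκ⟩ := H2
  obtain ⟨M, δ, hM1, hδ, hMexp⟩ := exists_norm_rescaled_le hCν
  have hS := hT.rescaled C
  have hMle : ∀ t, 0 ≤ t → ‖rescaled C T t‖ ≤ M := fun t ht =>
    (hMexp t ht).trans (mul_le_of_le_one_right (by linarith)
      (Real.exp_le_one_iff.2 (by nlinarith)))
  -- The smallness condition involves the exact supremum; `M` only shows that it is a genuine bound.
  have hsup : ∀ t, 0 ≤ t → ‖rescaled C T t‖ ≤ supNorm (rescaled C T) := fun t ht =>
    le_csSup ⟨M, by rintro _ ⟨s, hs, rfl⟩; exact hMle s hs⟩ ⟨t, ht, rfl⟩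
  have hSj := hS.isJointlyContinuous hMle
  have hTj : IsJointlyContinuous T := by
    have := hSj.rescaled (-C)
    rwa [rescaled_neg_rescaled] at this
  obtain ⟨hunit, hsum⟩ := isUnit_one_sub hS hδ hω hMexp
  have hSpos := hpos.rescaled C
  refine ⟨hunit, ?_⟩
  set Q : (ℝ → E) → ℝ → E := iterOp T F ω τ C
  set f : (ℝ → E) → ℝ → E := shiftedNonlinearity F τ C
  set I := periodicIcc ω v₀ w₀
  have hv₀c := hv.contDiff.continuous
  have hw₀c := hw.contDiff.continuous
  have hv₀I : v₀ ∈ I := ⟨hv₀c, hv.periodic, fun _ => le_rfl, hvw⟩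
  have hw₀I : w₀ ∈ I := ⟨hw₀c, hw.periodic, hvw, fun _ => le_rfl⟩
  have hfc : ∀ u ∈ I, Continuous (f u) := fun u hu => continuous_shiftedNonlinearity hF τ C hu.1
  have hfp : ∀ u ∈ I, Function.Periodic (f u) ω := fun u hu =>
    periodic_shiftedNonlinearity hFper τ C hu.2.1
  have hfmono : ∀ u₁ ∈ I, ∀ u₂ ∈ I, (∀ t, u₁ t ≤ u₂ t) → ∀ t, f u₁ t ≤ f u₂ t :=
    fun u₁ h₁ u₂ h₂ h => shiftedNonlinearity_mono hC₁ H3 hC₃ H4 hC h₁ h₂ h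
  have hQmono : ∀ u₁ ∈ I, ∀ u₂ ∈ I, (∀ t, u₁ t ≤ u₂ t) → ∀ t, Q u₁ t ≤ Q u₂ t :=
    fun u₁ h₁ u₂ h₂ h => periodicSolution_mono hSj hSpos hω.le hsum (hfc u₁ h₁) (hfc u₂ h₂)
      (hfmono u₁ h₁ u₂ h₂ h)
  -- `v₀` is itself the periodic solution with right-hand side `v₀' + A v₀ + C v₀ ≤ f v₀`.
  have hvQ : ∀ t, v₀ t ≤ Q v₀ t := fun t => by
    rw [hv.toIsPeriodicRegular.eq_periodicSolution hT hgen hTj hω.le hunit t]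
    exact periodicSolution_mono hSj hSpos hω.le hsum
      (((hv.contDiff.continuous_deriv (by simp)).add hv.continuous_apply).add (hv₀c.const_smul C))
      (hfc v₀ hv₀I) (fun s => add_le_add_left (hv.le s) _) t
  have hwQ : ∀ t, Q w₀ t ≤ w₀ t := fun t => by
    refine le_of_le_of_eq ?_
      (hw.toIsPeriodicRegular.eq_periodicSolution hT hgen hTj hω.le hunit t).symm
    exact periodicSolution_mono hSj hSpos hω.le hsum (hfc w₀ hw₀I)
      (((hw.contDiff.continuous_deriv (by simp)).add hw.continuous_apply).add (hw₀c.const_smul C))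
      (fun s => add_le_add_left (hw.ge s) _) t
  have hQI : ∀ u ∈ I, Q u ∈ I := fun u hu =>
    ⟨continuous_periodicSolution hSj hω.le (hfc u hu),
      periodic_periodicSolution hω.le (hfp u hu),
      fun t => (hvQ t).trans (hQmono v₀ hv₀I u hu hu.2.2.1 t),
      fun t => (hQmono u hu w₀ hw₀I hu.2.2.2 t).trans (hwQ t)⟩
  obtain ⟨Kv, hKv⟩ := exists_norm_le_of_periodic hω (hfc v₀ hv₀I) (hfp v₀ hv₀I)
  obtain ⟨Kd, hKd⟩ := exists_norm_le_of_periodic hω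
    ((hfc w₀ hw₀I).sub (hfc v₀ hv₀I)) ((hfp w₀ hw₀I).sub (hfp v₀ hv₀I))
  obtain ⟨Rv, hRv⟩ := exists_norm_le_of_periodic hω hv₀c hv.periodic
  obtain ⟨Rd, hRd⟩ := exists_norm_le_of_periodic hω (hw₀c.sub hv₀c)
    (hw.periodic.sub hv.periodic)
  -- Normality applied to `0 ≤ x - a ≤ b - a` makes order bounds into norm bounds.
  have hbound : ∀ {a x b : E} {A B : ℝ}, a ≤ x → x ≤ b → ‖a‖ ≤ A → ‖b - a‖ ≤ B →
      ‖x‖ ≤ A + |N| * B := by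
    intro a x b A B hax hxb ha hb
    have h1 := hN _ _ (sub_nonneg.2 hax) (sub_le_sub_right hxb a)
    have h2 : N * ‖b - a‖ ≤ |N| * B :=
      mul_le_mul (le_abs_self N) hb (norm_nonneg _) (abs_nonneg N)
    have h3 := norm_le_norm_add_norm_sub' x a
    linarith
  have hfK : ∀ u ∈ I, ∀ t, ‖f u t‖ ≤ Kv + |N| * Kd := fun u hu t =>
    hbound (hfmono v₀ hv₀I u hu hu.2.2.1 t) (hfmono u hu w₀ hw₀I hu.2.2.2 t) (hKv t) (hKd t)
  have hIR : ∀ u ∈ I, ∀ t, ‖u t‖ ≤ Rv + |N| * Rd := fun u hu t =>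
    hbound (hu.2.2.1 t) (hu.2.2.2 t) (hRv t) (hRd t)
  have hconv : ∀ z : ℕ → ℝ → E, (∀ n, z n ∈ I) → (∀ n, z (n + 1) = Q (z n)) →
      (Monotone z ∨ Antitone z) →
      ∃ u ∈ I, TendstoUniformly z u atTop ∧ IsPeriodicMildSolution T F ω τ u := by
    intro z hzI hzQ hz
    obtain ⟨u, huc, hup, hlim⟩ := exists_tendstoUniformly_iterates hN hS hSj hsup hω hunit hz
      (fun n => (hzI n).1) (fun n => (hzI n).2.1) (f := fun n => f (z n))
      (fun n t => congrFun (hzQ n) t) (fun n => hfc _ (hzI n)) (fun n => hfp _ (hzI n))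
      (fun n => hfK _ (hzI n)) (fun n => hIR _ (hzI n)) hc (hκ z hzI hz) hlt
    have hpt : ∀ t, Tendsto (fun n => z n t) atTop (𝓝 (u t)) := fun t => hlim.tendsto_at t
    have huI : u ∈ I := ⟨huc, hup, fun t => ge_of_tendsto' (hpt t) fun n => (hzI n).2.2.1 t,
      fun t => le_of_tendsto' (hpt t) fun n => (hzI n).2.2.2 t⟩
    refine ⟨u, huI, hlim, isPeriodicMildSolution_of_fixedPoint hT hSj hF hω.le hFper hunit huc hup
      fun t => ?_⟩
    -- Dominated convergence inside `Q` shows that the limit is a fixed point.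
    have h1 : Tendsto (fun n => z (n + 1) t) atTop (𝓝 (Q u t)) := by
      simp only [hzQ]
      exact tendsto_periodicSolution hSj hMle hω.le (fun n => hfc _ (hzI n))
        (fun n => hfK _ (hzI n)) (tendsto_shiftedNonlinearity hF τ C hpt) t
    exact tendsto_nhds_unique h1 ((hpt t).comp (tendsto_add_atTop_nat 1))
  let v : ℕ → ℝ → E := fun n => Q^[n] v₀
  let w : ℕ → ℝ → E := fun n => Q^[n] w₀
  have hvs : ∀ n, v (n + 1) = Q (v n) := fun n => Function.iterate_succ_apply' Q n v₀
  have hws : ∀ n, w (n + 1) = Q (w n) := fun n => Function.iterate_succ_apply' Q n w₀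
  have hvI : ∀ n, v n ∈ I := fun n => by
    induction n with
    | zero => exact hv₀I
    | succ n ih => rw [hvs]; exact hQI _ ih
  have hwI : ∀ n, w n ∈ I := fun n => by
    induction n with
    | zero => exact hw₀I
    | succ n ih => rw [hws]; exact hQI _ ih
  have hvmono : Monotone v := monotone_nat_of_le_succ fun n => by
    induction n with
    | zero => exact hvQ
    | succ n ih => rw [hvs, hvs (n + 1)]; exact hQmono _ (hvI _) _ (hvI _) ih
  have hwanti : Antitone w := antitone_nat_of_succ_le fun n => by
    induction n with
    | zero => exact hwQ
    | succ n ih =>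
      rw [hws (n + 1)]
      conv_rhs => rw [hws]
      exact hQmono _ (hwI _) _ (hwI _) ih
  have hvw' : ∀ n, v n ≤ w n := fun n => by
    induction n with
    | zero => exact hvw
    | succ n ih => rw [hvs, hws]; exact hQmono _ (hvI _) _ (hwI _) ih
  obtain ⟨umin, hminI, hminlim, hminmild⟩ := hconv v hvI hvs (Or.inl hvmono)
  obtain ⟨umax, hmaxI, hmaxlim, hmaxmild⟩ := hconv w hwI hws (Or.inr hwanti)
  refine ⟨v, w, rfl, rfl, hvs, hws, hvI, hwI, hvmono, hwanti, hvw', umin, hminI, umax, hmaxI,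
    hminlim, hmaxlim, hminmild, hmaxmild, fun u hu humild t => ?_⟩
  -- Being fixed by the increasing map `Q`, the solution stays between the iterates by induction.
  have hQu : Q u = u := funext (humild.iterOp_eq hT hTj hF hω.le hunit)
  have hvu : ∀ n, v n ≤ u := fun n => by
    induction n with
    | zero => exact hu.2.2.1
    | succ n ih => rw [hvs, ← hQu]; exact hQmono _ (hvI _) _ hu ih
  have huw : ∀ n, u ≤ w n := fun n => by
    induction n with
    | zero => exact hu.2.2.2
    | succ n ih => rw [hws, ← hQu]; exact hQmono _ hu _ (hwI _) ih
  exact ⟨le_of_tendsto' (hminlim.tendsto_at t) fun n => hvu n t,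
    ge_of_tendsto' (hmaxlim.tendsto_at t) fun n => huw n t⟩
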